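/- Let $M$ be an oriented smooth three-manifold (without boundary), $g$ a smooth Lorentzian metric on $M$ of signature $(-,+,+)$, and $\alpha$ a smooth one-form on $M$. Let $\nu$ be the volume form of $g$, $\ast$ the Hodge star of $g$ and the orientation, normalised by $\beta\wedge\ast\gamma=\langle\beta,\gamma\rangle_g\,\nu$, and $\xi=\alpha^\sharp$ the metric dual vector field of $\alpha$ (the Reeb vector field). Suppose that $(g,\alpha)$ is a null contact structure, that is, $$\alpha=\ast\,\mathrm d\alpha,\qquad |\alpha|_g^2=g(\xi,\xi)=0,$$ where $\mathrm d\alpha(X,Y)=X(\alpha(Y))-Y(\alpha(X))-\alpha([X,Y])$, and suppose that $\alpha$ vanishes nowhere on $M$. Let $\phi\colon TM\to TM$, $\phi(v)=(\iota_v\ast\alpha)^\sharp$, be the characteristic endomorphism of $(g,\alpha)$. The structure $(g,\alpha)$ is called Sasakian if $\mathcal L_\xi\phi=0$, i.e. $[\xi,\phi(X)]=\phi([\xi,X])$ for all smooth vector fields $X$ on $M$. Let $q$ be the canonical coordinate on $\mathbb R$ and define the field of endomorphisms $J$ of $T(M\times\mathbb R)$ by $$J(v,c\,\partial_q)=(\phi(v)+c\,\xi,\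 \alpha(v)\,\partial_q).$$ Then $J^2=0$, and $(g,\alpha)$ is Sasakian if and only if $J$ is integrable, meaning that around every point of $M\times\mathbb R$ there is a smooth coordinate system in which the matrix of $J$ has constant coefficients. -/

import Mathlib

open Set Filter Topology Bundle Module
open scoped Manifold ContDiff

/- An identity-like instance that would otherwise wrap the charted space structures below. -/
attribute [-instance] TopCat.of.chartedSpace

noncomputable section

/-! ### Linear algebra of an oriented three-dimensional Lorentzian vector space -/

section LinearAlgebra

variable {V : Type*} [AddCommGroup V] [Module ℝ V]

/-- A bilinear form of signature `(-,+,+)`: it has a basis with Gram matrix `diag(-1, 1, 1)`. -/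
def IsLorentzianForm (B : LinearMap.BilinForm ℝ V) : Prop :=
  ∃ b : Basis (Fin 3) ℝ V, ∀ i j, B (b i) (b j) = if i = j then (if i = 0 then -1 else 1) else 0

theorem IsLorentzianForm.nondegenerate {B : LinearMap.BilinForm ℝ V} (hB : IsLorentzianForm B) :
    B.Nondegenerate := by
  obtain ⟨b, hb⟩ := hB
  refine (LinearMap.BilinForm.nondegenerate_iff_det_ne_zero b).mpr ?_
  simp [Matrix.det_fin_three, LinearMap.BilinForm.toMatrix_apply, hb]

theorem IsLorentzianForm.card_eq {B : LinearMap.BilinForm ℝ V} (hB : IsLorentzianForm B) :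
    Fintype.card (Fin 3) = finrank ℝ V := by
  obtain ⟨b, -⟩ := hB
  exact (finrank_eq_card_basis b).symm

variable [FiniteDimensional ℝ V]

/-- The metric dual `β♯` of a covector `β`, characterised by `B β♯ v = β v`. -/
def lorentzSharp {B : LinearMap.BilinForm ℝ V} (hB : IsLorentzianForm B) :
    Dual ℝ V →ₗ[ℝ] V :=
  (B.toDual hB.nondegenerate).symm.toLinearMap

/-- The volume form `ν` of `B` and the orientation `o`: on a positively oriented basis `b`
it takes the value `√|det (B (b i) (b j))|`. -/
def lorentzVolume {B : LinearMap.BilinForm ℝ V} (hB : IsLorentzianForm B)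
    (o : Orientation ℝ V (Fin 3)) : V [⋀^Fin 3]→ₗ[ℝ] ℝ :=
  let b := o.someBasis hB.card_eq
  √|(Matrix.of fun i j => B (b i) (b j)).det| • b.det

/-- The Hodge dual of a one-form `β`: the two-form `(∗β)(v, w) = βⁱ ν(bᵢ, v, w) = ν(β♯, v, w)`. -/
def hodgeStarOne {B : LinearMap.BilinForm ℝ V} (hB : IsLorentzianForm B)
    (o : Orientation ℝ V (Fin 3)) (β : Dual ℝ V) : V →ₗ[ℝ] V →ₗ[ℝ] ℝ :=
  let ν := lorentzVolume hB o
  let x := lorentzSharp hB β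
  LinearMap.mk₂ ℝ (fun v w => ν ![x, v, w])
    (fun v v' w => (ν.curryLeft x).map_vecCons_add ![w] v v')
    (fun c v w => (ν.curryLeft x).map_vecCons_smul ![w] c v)
    (fun v w w' => ((ν.curryLeft x).curryLeft v).map_vecCons_add ![] w w')
    (fun c v w => ((ν.curryLeft x).curryLeft v).map_vecCons_smul ![] c w)

/-- The Hodge dual of a two-form `β`: the one-form `(∗β)(v) = ½ βⁱʲ ν(bᵢ, bⱼ, v)`, the indices being
raised with `B`; equivalently `(∗β)(v) = ½ ∑ β(bᵢ, bⱼ) ν(bⁱ, bʲ, v)`, where `bⁱ` is the metric dual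
of the `i`-th coordinate covector of the basis `b`. The result does not depend on `b`. -/
def hodgeStarTwo {B : LinearMap.BilinForm ℝ V} (hB : IsLorentzianForm B)
    (o : Orientation ℝ V (Fin 3)) (β : V → V → ℝ) (v : V) : ℝ :=
  let b := o.someBasis hB.card_eq
  (1 / 2 : ℝ) * ∑ i, ∑ j, β (b i) (b j) *
    lorentzVolume hB o ![lorentzSharp hB (b.coord i), lorentzSharp hB (b.coord j), v]

end LinearAlgebra

/-! ### Tensors on a three-manifold -/

/-- The model space of three-manifolds. -/
abbrev E3 : Type := EuclideanSpace ℝ (Fin 3)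

section ThreeManifold

variable (M : Type*) [TopologicalSpace M] [ChartedSpace E3 M] [IsManifold (𝓡 3) ∞ M]

/-- A smooth Lorentzian metric, of signature `(-,+,+)`, on the three-manifold `M`. -/
structure LorentzianMetric where
  inner (p : M) : TangentSpace (𝓡 3) p →L[ℝ] TangentSpace (𝓡 3) p →L[ℝ] ℝ
  symm (p : M) (v w : TangentSpace (𝓡 3) p) : inner p v w = inner p w v
  lorentzian (p : M) : IsLorentzianForm (V := TangentSpace (𝓡 3) p) (inner p).toLinearMap₁₂
  contMDiff : ContMDiff (𝓡 3) ((𝓡 3).prod 𝓘(ℝ, E3 →L[ℝ] E3 →L[ℝ] ℝ)) ∞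
    (fun p ↦ TotalSpace.mk' (E3 →L[ℝ] E3 →L[ℝ] ℝ)
      (E := fun p : M ↦ TangentSpace (𝓡 3) p →L[ℝ] TangentSpace (𝓡 3) p →L[ℝ] ℝ) p (inner p))

/-- A smooth one-form on `M`. -/
structure OneForm where
  toFun (p : M) : TangentSpace (𝓡 3) p →L[ℝ] ℝ
  contMDiff : ContMDiff (𝓡 3) ((𝓡 3).prod 𝓘(ℝ, E3 →L[ℝ] ℝ)) ∞
    (fun p ↦ TotalSpace.mk' (E3 →L[ℝ] ℝ)
      (E := fun p : M ↦ TangentSpace (𝓡 3) p →L[ℝ] ℝ) p (toFun p))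

instance : CoeFun (OneForm M) (fun _ => ∀ p : M, TangentSpace (𝓡 3) p →L[ℝ] ℝ) := ⟨OneForm.toFun⟩

/-- An orientation of `M`: an orientation of every tangent space, locally constant in charts.
That is, for `x` near `p`, bases of `T_xM` and `T_pM` with the same components in the chart at `p`
are both positively oriented or both negatively oriented. -/
structure ManifoldOrientation where
  toFun (p : M) : Orientation ℝ (TangentSpace (𝓡 3) p) (Fin 3)
  locally_constant (p : M) : ∀ᶠ x in 𝓝 p,
    ∀ (b : Basis (Fin 3) ℝ (TangentSpace (𝓡 3) x)) (b' : Basis (Fin 3) ℝ (TangentSpace (𝓡 3) p)),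
      (∀ i, mfderiv (𝓡 3) 𝓘(ℝ, E3) (extChartAt (𝓡 3) p) x (b i) =
        mfderiv (𝓡 3) 𝓘(ℝ, E3) (extChartAt (𝓡 3) p) p (b' i)) →
      (b.orientation = toFun x ↔ b'.orientation = toFun p)

variable {M}

instance (p : M) : FiniteDimensional ℝ (TangentSpace (𝓡 3) p) :=
  inferInstanceAs (FiniteDimensional ℝ E3)

/-- A smooth vector field on `M`. -/
def IsSmoothVectorField (X : ∀ p : M, TangentSpace (𝓡 3) p) : Prop :=
  ContMDiff (𝓡 3) (𝓡 3).tangent ∞ (fun p ↦ (⟨p, X p⟩ : TangentBundle (𝓡 3) M))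

/-- The components of the one-form `α` in the chart at `p`, a one-form on the model space. -/
def OneForm.inChart (α : OneForm M) (p : M) (y : E3) : E3 →L[ℝ] ℝ :=
  (α ((extChartAt (𝓡 3) p).symm y)).comp (mfderiv 𝓘(ℝ, E3) (𝓡 3) (extChartAt (𝓡 3) p).symm y)

/-- The exterior derivative `dα`, with the convention `dα(X, Y) = X(α(Y)) - Y(α(X)) - α([X, Y])`;
in coordinates `dα(∂ᵢ, ∂ⱼ) = ∂ᵢαⱼ - ∂ⱼαᵢ`. -/
def OneForm.extDeriv (α : OneForm M) (p : M) (v w : TangentSpace (𝓡 3) p) : ℝ :=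
  let c := mfderiv (𝓡 3) 𝓘(ℝ, E3) (extChartAt (𝓡 3) p) p
  let D : E3 →L[ℝ] E3 →L[ℝ] ℝ := fderiv ℝ (α.inChart p) (extChartAt (𝓡 3) p p)
  D (c v) (c w) - D (c w) (c v)

/-! ### Null contact structures -/

/-- The Reeb vector field `ξ = α♯`. -/
def reebField (g : LorentzianMetric M) (α : OneForm M) (p : M) : TangentSpace (𝓡 3) p :=
  lorentzSharp (g.lorentzian p) (α p).toLinearMap

/-- `(g, α)` is a null contact structure on the oriented manifold `(M, o)`:
`α = ∗dα` and `|α|²_g = g(ξ, ξ) = 0`. -/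
structure IsNullContact (o : ManifoldOrientation M) (g : LorentzianMetric M) (α : OneForm M) :
    Prop where
  eq_hodge : ∀ (p : M) (v : TangentSpace (𝓡 3) p),
    α p v = hodgeStarTwo (g.lorentzian p) (o.toFun p) (α.extDeriv p) v
  null : ∀ p : M, g.inner p (reebField g α p) (reebField g α p) = 0

/-- The characteristic endomorphism `φ(v) = -s (ι_v ∗α)♯`, where `s = -1` is the sign of a
Lorentzian metric, that is `φ(v) = (ι_v ∗α)♯`. -/
def charEndo (o : ManifoldOrientation M) (g : LorentzianMetric M) (α : OneForm M) (p : M) :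
    TangentSpace (𝓡 3) p →ₗ[ℝ] TangentSpace (𝓡 3) p :=
  lorentzSharp (g.lorentzian p) ∘ₗ hodgeStarOne (g.lorentzian p) (o.toFun p) (α p).toLinearMap

/-- The Lie derivative of a field of endomorphisms, as an operator on vector fields:
`(L_ξ φ)(X) = [ξ, φ(X)] - φ([ξ, X])`. -/
def lieDerivEndo (ξ : ∀ p : M, TangentSpace (𝓡 3) p)
    (φ : ∀ p : M, TangentSpace (𝓡 3) p →ₗ[ℝ] TangentSpace (𝓡 3) p)
    (X : ∀ p : M, TangentSpace (𝓡 3) p) (p : M) : TangentSpace (𝓡 3) p :=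
  VectorField.mlieBracket (𝓡 3) ξ (fun x => φ x (X x)) p -
    φ p (VectorField.mlieBracket (𝓡 3) ξ X p)

/-- `(g, α)` is Sasakian: the tensor `h = L_ξ φ` vanishes. -/
def IsSasakian (o : ManifoldOrientation M) (g : LorentzianMetric M) (α : OneForm M) : Prop :=
  ∀ X : ∀ p : M, TangentSpace (𝓡 3) p, IsSmoothVectorField X →
    ∀ p : M, lieDerivEndo (reebField g α) (charEndo o g α) X p = 0

/-- The endomorphism `J(v, c ∂_q) = (φ(v) + c ξ, α(v) ∂_q)` of `T(M × ℝ)`, under the identification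
`T_{(p,q)}(M × ℝ) = T_pM × ℝ`. -/
def contactJ (o : ManifoldOrientation M) (g : LorentzianMetric M) (α : OneForm M) (x : M × ℝ) :
    TangentSpace ((𝓡 3).prod 𝓘(ℝ, ℝ)) x →ₗ[ℝ] TangentSpace ((𝓡 3).prod 𝓘(ℝ, ℝ)) x :=
  (((charEndo o g α x.1 ∘ₗ LinearMap.fst ℝ _ _ +
      (LinearMap.snd ℝ _ _).smulRight (reebField g α x.1)).prod
    ((α x.1).toLinearMap ∘ₗ LinearMap.fst ℝ _ _) :
      TangentSpace (𝓡 3) x.1 × ℝ →ₗ[ℝ] TangentSpace (𝓡 3) x.1 × ℝ) :)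

theorem contactJ_apply (o : ManifoldOrientation M) (g : LorentzianMetric M) (α : OneForm M)
    (x : M × ℝ) (v : TangentSpace (𝓡 3) x.1) (c : ℝ) :
    contactJ o g α x ((v, c) : TangentSpace (𝓡 3) x.1 × ℝ) =
      ((charEndo o g α x.1 v + c • reebField g α x.1, α x.1 v) : TangentSpace (𝓡 3) x.1 × ℝ) :=
  rfl

end ThreeManifold

/-- A field of endomorphisms `T` of the tangent bundle of a manifold `N` without boundary is
integrable if around every point there is a smooth coordinate system (a chart `e` of the maximal
atlas) in which the matrix of `T` is constant: `de ∘ T = A ∘ de` for a fixed linear map `A`. -/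
def IsIntegrableEndo {E : Type*} [NormedAddCommGroup E] [NormedSpace ℝ E] {H : Type*}
    [TopologicalSpace H] (I : ModelWithCorners ℝ E H) [I.Boundaryless] {N : Type*}
    [TopologicalSpace N] [ChartedSpace H N]
    (T : ∀ x : N, TangentSpace I x →ₗ[ℝ] TangentSpace I x) : Prop :=
  ∀ n : N, ∃ e ∈ IsManifold.maximalAtlas I ∞ N, n ∈ e.source ∧
    ∃ A : E →ₗ[ℝ] E, ∀ x ∈ e.source, ∀ v : TangentSpace I x,
      mfderiv I 𝓘(ℝ, E) (e.extend I) x (T x v) = A (mfderiv I 𝓘(ℝ, E) (e.extend I) x v)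

end

/-! The pointwise content is `charEndo_algebra`: for a null covector, φ² = -α ⊗ ξ, φξ = 0, α ∘ φ = 0
and α(ξ) = 0. These identities give J² = 0. On two-forms ∗∗ = -1, so α = ∗dα turns into dα = -∗α,
that is dα(v, w) = -g(φv, w) (`IsNullContact.extDeriv_eq`). Hence dα(φv, w) = α(v) α(w). Where α is
nonzero, im φ = ker α and ker φ is spanned by ξ.

Integrable implies Sasakian: constant coefficients force the Nijenhuis identity [JV, JT] = J([JV, T]
+ [V, JT] - J[V, T]). For V = (X, 0) and T = ∂_q the brackets with T vanish and JT = (ξ, 0), so the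
M-component of the identity reads [φX, ξ] = φ[X, ξ] (`lieBracket_eq_of_constant_coefficients`).

Sasakian implies integrable: dα vanishes on ker α, so Frobenius gives α = h dz with h > 0. The
formula for dα(φv, w) becomes dh ∘ φ = hα, so l = log h satisfies dl ∘ φ = α and dl(ξ) = 0.
Therefore β(φv) = -dl(v) is well defined on ker α and β(ξ) = 1. The Sasakian condition is what makes
dβ(ξ, φn) vanish, so that β = df along ker α (`exists_primitive_comp_charEndo`). In the coordinates
(x₁, x₂, x₃, x₄) = (f, -1/h, z, q - l) one finds dx₁ ∘ J = dx₄, dx₂ ∘ J = dx₃ and dx₃ ∘ J = dx₄ ∘ J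
= 0, a constant matrix (`exists_constant_coefficients`).

Frobenius and the primitive along the leaves come from one total differential equation
(`exists_integrating_factor_and_primitive`), solved along rays by an ordinary differential equation
(`exists_total_differential_solution`). Smooth dependence on parameters comes from the inverse
function theorem in a space of continuous curves. The remaining work transports these local
statements through charts of M. -/

/-! ### Inverse functions and superposition operators -/

section Analysis

/-- The inverse function theorem, with a source on which everything is smooth. -/
theorem exists_openPartialHomeomorph_of_contDiffAt {E E' : Type*} [NormedAddCommGroup E]
    [NormedSpace ℝ E] [CompleteSpace E] [NormedAddCommGroup E'] [NormedSpace ℝ E']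
    {f : E → E'} {a : E} (hf : ∀ᶠ x in 𝓝 a, ContDiffAt ℝ ∞ f x) {f' : E ≃L[ℝ] E'}
    (hf' : HasFDerivAt f (f' : E →L[ℝ] E') a) :
    ∃ e : OpenPartialHomeomorph E E', ⇑e = f ∧ a ∈ e.source ∧
      ∀ x ∈ e.source, ContDiffAt ℝ ∞ f x ∧ ContDiffAt ℝ ∞ e.symm (f x) := by
  have ha := hf.self_of_nhds
  let e₀ := ha.toOpenPartialHomeomorph f hf' (by simp)
  have he₀ : ⇑e₀ = f := ha.toOpenPartialHomeomorph_coe hf' (by simp)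
  have hc : ContinuousAt (fderiv ℝ f) a :=
    (ha.fderiv_right (m := 0) (by simp)).continuousAt
  -- Invertible operators form an open set. Restricting to points with invertible derivative makes
  -- the inverse smooth on the whole image, not only at `f a`.
  have hinv : ∀ᶠ x in 𝓝 a, fderiv ℝ f x ∈ range ((↑) : (E ≃L[ℝ] E') → E →L[ℝ] E') := by
    apply hc
    rw [hf'.fderiv]
    exact ContinuousLinearEquiv.nhds f'
  obtain ⟨s, hs, hso, has⟩ := eventually_nhds_iff.1 (hf.and hinv)
  refine ⟨e₀.restrOpen s hso, he₀, ⟨ha.mem_toOpenPartialHomeomorph_source hf' (by simp), has⟩, ?_⟩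
  intro x hx
  refine ⟨(hs x hx.2).1, ?_⟩
  obtain ⟨L, hL⟩ := (hs x hx.2).2
  have hx' : e₀.symm (f x) = x := by rw [← he₀]; exact e₀.left_inv hx.1
  refine e₀.contDiffAt_symm (f₀' := L) ?_ ?_ ?_
  · rw [← he₀]; exact e₀.map_source hx.1
  · rw [hx', he₀, hL]
    exact ((hs x hx.2).1.differentiableAt (by simp)).hasFDerivAt
  · rw [hx', he₀]; exact (hs x hx.2).1

universe u

variable {T : Type*} [TopologicalSpace T] [CompactSpace T]

set_option synthInstance.maxHeartbeats 400000 in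
noncomputable instance ContinuousMap.instNormedAddCommGroupCLM {E F : Type*}
    [NormedAddCommGroup E] [NormedSpace ℝ E] [NormedAddCommGroup F] [NormedSpace ℝ F] :
    NormedAddCommGroup C(T, E →L[ℝ] F) :=
  ContinuousMap.instNormedAddCommGroup

set_option synthInstance.maxHeartbeats 400000 in
noncomputable instance ContinuousMap.instNormedSpaceCLM {E F : Type*}
    [NormedAddCommGroup E] [NormedSpace ℝ E] [NormedAddCommGroup F] [NormedSpace ℝ F] :
    NormedSpace ℝ C(T, E →L[ℝ] F) :=
  ContinuousMap.normedSpace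

/-- A continuous family of linear maps acts on continuous functions. -/
noncomputable def ContinuousMap.clmApply (T : Type*) [TopologicalSpace T] [CompactSpace T]
    (E F : Type*) [NormedAddCommGroup E] [NormedSpace ℝ E] [NormedAddCommGroup F]
    [NormedSpace ℝ F] : C(T, E →L[ℝ] F) →L[ℝ] C(T, E) →L[ℝ] C(T, F) :=
  LinearMap.mkContinuous₂
    (LinearMap.mk₂ ℝ (fun A γ => ⟨fun t => A t (γ t), by fun_prop⟩)
      (fun _ _ _ => by ext; simp) (fun _ _ _ => by ext; simp)
      (fun _ _ _ => by ext; simp) (fun _ _ _ => by ext; simp)) 1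
    (fun A γ => by
      rw [ContinuousMap.norm_le _ (by positivity)]
      intro t
      rw [one_mul]
      exact ((A t).le_opNorm _).trans
        (mul_le_mul (A.norm_coe_le_norm t) (γ.norm_coe_le_norm t) (norm_nonneg _) (norm_nonneg _)))

@[simp]
theorem ContinuousMap.clmApply_apply {E F : Type*} [NormedAddCommGroup E] [NormedSpace ℝ E]
    [NormedAddCommGroup F] [NormedSpace ℝ F] (A : C(T, E →L[ℝ] F)) (γ : C(T, E)) (t : T) :
    ContinuousMap.clmApply T E F A γ t = A t (γ t) := rfl

/-- The mean value inequality is applied at each time t. Its error is uniform in t because γ ↦ k' ∘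
γ is continuous for the sup norm. -/
theorem hasFDerivAt_continuousMap_comp {E F : Type*} [NormedAddCommGroup E] [NormedSpace ℝ E]
    [NormedAddCommGroup F] [NormedSpace ℝ F] (k : C(E, F)) (k' : C(E, E →L[ℝ] F))
    (hk : ∀ x, HasFDerivAt k (k' x) x) (γ : C(T, E)) :
    HasFDerivAt (fun γ : C(T, E) => k.comp γ)
      (ContinuousMap.clmApply T E F (k'.comp γ)) γ := by
  rw [hasFDerivAt_iff_isLittleO_nhds_zero, Asymptotics.isLittleO_iff]
  intro ε hε
  have hcont : Continuous fun γ : C(T, E) => k'.comp γ := ContinuousMap.continuous_postcomp k'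
  obtain ⟨r, hr, hball⟩ := Metric.continuousAt_iff.1 hcont.continuousAt ε hε
  filter_upwards [Metric.ball_mem_nhds (0 : C(T, E)) hr] with δ hδ
  rw [mem_ball_zero_iff] at hδ
  rw [ContinuousMap.norm_le _ (by positivity)]
  intro t
  have hδt : ‖δ t‖ < r := (δ.norm_coe_le_norm t).trans_lt hδ
  have key := Convex.norm_image_sub_le_of_norm_hasFDerivWithin_le' (𝕜 := ℝ) (f := k)
    (f' := fun y => k' y) (φ := k' (γ t)) (C := ε) (s := Metric.ball (γ t) r)
    (x := γ t) (y := γ t + δ t)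
    (fun y _ => (hk y).hasFDerivWithinAt) (fun y hy => by
      -- Shifting γ by a constant makes it pass through y at time t, so sup-norm continuity bounds
      -- k' y - k' (γ t).
      have h1 : dist (γ + ContinuousMap.const T (y - γ t)) γ < r := by
        rw [dist_eq_norm, add_sub_cancel_left]
        refine (ContinuousMap.norm_lt_iff _ hr).2 fun s => ?_
        simpa [dist_eq_norm] using hy
      have h2 := (ContinuousMap.dist_lt_iff hε).1 (hball h1) t
      simpa [dist_eq_norm] using h2.le)
    (convex_ball _ _) (Metric.mem_ball_self hr) (by simpa [dist_eq_norm] using hδt)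
  simp only [add_sub_cancel_left] at key
  exact key.trans (mul_le_mul_of_nonneg_left (δ.norm_coe_le_norm t) hε.le)

/-- Superposition with a smooth map is a smooth map between spaces of continuous functions. -/
theorem contDiff_continuousMap_comp {E F : Type u} [NormedAddCommGroup E] [NormedSpace ℝ E]
    [NormedAddCommGroup F] [NormedSpace ℝ F] (k : C(E, F)) (hk : ContDiff ℝ ∞ k) :
    ContDiff ℝ ∞ (fun γ : C(T, E) => k.comp γ) := by
  rw [contDiff_infty]
  intro n
  induction n generalizing F with
  | zero => exact contDiff_zero.2 (ContinuousMap.continuous_postcomp k)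
  | succ n ih =>
    -- The derivative is a fixed bounded bilinear operator applied to superposition with k', so the
    -- induction passes to the target `E →L[ℝ] F`. This is why E and F share a universe.
    let k' : C(E, E →L[ℝ] F) := ⟨fderiv ℝ k, hk.continuous_fderiv (by simp)⟩
    have hk' : ContDiff ℝ ∞ k' := hk.fderiv_right (by simp)
    have hd := fun γ : C(T, E) => hasFDerivAt_continuousMap_comp k k'
      (fun x => (hk.differentiable (by simp) x).hasFDerivAt) γ
    push_cast
    rw [contDiff_succ_iff_hasFDerivAt]
    exact ⟨_, (ContinuousMap.clmApply T E F).contDiff.comp (ih k' hk'), hd⟩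

/-- The operator `g ↦ ∫₀ᵗ g` on continuous functions on the unit interval. -/
noncomputable def volterraIntegral (F : Type*) [NormedAddCommGroup F] [NormedSpace ℝ F]
    [CompleteSpace F] :
    C(Icc (0 : ℝ) 1, F) →L[ℝ] C(Icc (0 : ℝ) 1, F) :=
  LinearMap.mkContinuous
    { toFun := fun g => ⟨fun t => ∫ s in (0 : ℝ)..t, IccExtend zero_le_one g s,
        (intervalIntegral.continuous_primitive
          (fun a b => (g.continuous.Icc_extend' (h := zero_le_one)).intervalIntegrable a b) 0).comp
            continuous_subtype_val⟩
      map_add' := fun g g' => by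
        ext t
        simp only [ContinuousMap.coe_mk, ContinuousMap.add_apply]
        rw [← intervalIntegral.integral_add
          ((g.continuous.Icc_extend' (h := zero_le_one)).intervalIntegrable _ _)
          ((g'.continuous.Icc_extend' (h := zero_le_one)).intervalIntegrable _ _)]
        rfl
      map_smul' := fun c g => by
        ext t
        simp only [ContinuousMap.coe_mk, ContinuousMap.smul_apply, RingHom.id_apply]
        rw [← intervalIntegral.integral_smul]
        rfl } 1
    (fun g => by
      rw [ContinuousMap.norm_le _ (by positivity)]
      intro t
      refine (intervalIntegral.norm_integral_le_of_norm_le_const (C := ‖g‖)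
        fun s _ => g.norm_coe_le_norm _).trans ?_
      have h0 := t.2.1
      have h1 := t.2.2
      rw [sub_zero, abs_of_nonneg h0, one_mul]
      exact mul_le_of_le_one_right (norm_nonneg _) h1)

theorem volterraIntegral_apply {F : Type*} [NormedAddCommGroup F] [NormedSpace ℝ F]
    [CompleteSpace F] (g : C(Icc (0 : ℝ) 1, F)) (t : Icc (0 : ℝ) 1) :
    volterraIntegral F g t = ∫ s in (0 : ℝ)..t, IccExtend zero_le_one g s := rfl

end Analysis

/-! ### Total differential equations -/

section TotalDifferential

universe u

/-- A bump function supported well inside the region of smoothness cuts f off. Superposition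
operators require a globally smooth map, while the equations are given only near a point. -/
theorem exists_contDiff_eventuallyEq {V W : Type*} [NormedAddCommGroup V] [NormedSpace ℝ V]
    [FiniteDimensional ℝ V] [NormedAddCommGroup W] [NormedSpace ℝ W] {f : V → W} {a : V}
    (hf : ∀ᶠ x in 𝓝 a, ContDiffAt ℝ ∞ f x) :
    ∃ g : V → W, ContDiff ℝ ∞ g ∧ g =ᶠ[𝓝 a] f := by
  obtain ⟨r, hr, hball⟩ := Metric.eventually_nhds_iff_ball.1 hf
  let χ : ContDiffBump a := ⟨r / 4, r / 2, by positivity, by linarith⟩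
  refine ⟨fun x => χ x • f x, contDiff_iff_contDiffAt.2 fun x => ?_, ?_⟩
  · by_cases hx : x ∈ Metric.ball a r
    · exact χ.contDiff.contDiffAt.smul (hball x hx)
    · have h0 : (fun x => χ x • f x) =ᶠ[𝓝 x] fun _ => 0 := by
        have hx' : x ∉ tsupport χ := by
          rw [χ.tsupport_eq]
          simp only [Metric.mem_closedBall, Metric.mem_ball, not_lt, not_le] at hx ⊢
          change r / 2 < _
          linarith
        filter_upwards [(isClosed_tsupport χ).isOpen_compl.mem_nhds hx'] with y hy
        rw [image_eq_zero_of_notMem_tsupport hy, zero_smul]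
      exact contDiffAt_const.congr_of_eventuallyEq h0
  · filter_upwards [χ.eventuallyEq_one] with x hx
    simp [hx]

/-- The curve `t ↦ (t, x, u t)` as an affine function of `(x, z)` and `u`. -/
noncomputable def timeSection {E F : Type*} [NormedAddCommGroup E] [NormedSpace ℝ E]
    [NormedAddCommGroup F] [NormedSpace ℝ F] :
    (E × F) × C(Icc (0 : ℝ) 1, F) →L[ℝ] C(Icc (0 : ℝ) 1, ℝ × E × F) :=
  LinearMap.mkContinuous
    { toFun := fun q => ⟨fun t => (0, q.1.1, q.2 t), by fun_prop⟩
      map_add' := fun _ _ => by ext t <;> simp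
      map_smul' := fun _ _ => by ext t <;> simp } 1
    (fun q => by
      rw [ContinuousMap.norm_le _ (by positivity), one_mul]
      intro t
      refine norm_prod_le_iff.2 ⟨by simp, norm_prod_le_iff.2 ⟨?_, ?_⟩⟩
      · exact (norm_fst_le q.1).trans (norm_fst_le q)
      · exact (q.2.norm_coe_le_norm t).trans (norm_snd_le q))

/-- Smooth dependence on parameters, when the parameter zero switches the equation off. -/
theorem exists_parametric_integral_solution {E F : Type u} [NormedAddCommGroup E]
    [NormedSpace ℝ E] [CompleteSpace E] [NormedAddCommGroup F] [NormedSpace ℝ F] [CompleteSpace F]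
    {k : ℝ × E × F → F} (hk : ContDiff ℝ ∞ k) (hk0 : ∀ t z, k (t, 0, z) = 0) (z₀ : F) :
    ∃ U : E × F → C(Icc (0 : ℝ) 1, F), (∀ᶠ p in 𝓝 (0, z₀), ContDiffAt ℝ ∞ U p) ∧
      U (0, z₀) = ContinuousMap.const _ z₀ ∧
      (∀ᶠ p in 𝓝 (0, z₀), ∀ t : Icc (0 : ℝ) 1,
        U p t = p.2 + ∫ s in (0 : ℝ)..t, k (s, p.1, IccExtend zero_le_one (U p) s)) ∧
      ∀ᶠ p in 𝓝 (0, z₀), ∀ (v : E) (t : Icc (0 : ℝ) 1),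
        fderiv ℝ U p (v, 0) t = ∫ s in (0 : ℝ)..t,
          fderiv ℝ k (s, p.1, IccExtend zero_le_one (U p) s)
            (0, v, IccExtend zero_le_one (fderiv ℝ U p (v, 0)) s) := by
  set X := C(Icc (0 : ℝ) 1, F) with hX
  let kc : C(ℝ × E × F, F) := ⟨k, hk.continuous⟩
  let kc' : C(ℝ × E × F, (ℝ × E × F) →L[ℝ] F) := ⟨fderiv ℝ k, hk.continuous_fderiv (by simp)⟩
  let τ : C(Icc (0 : ℝ) 1, ℝ × E × F) := ⟨fun t => (t, 0, 0), by fun_prop⟩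
  let Γ : (E × F) × X → C(Icc (0 : ℝ) 1, ℝ × E × F) := fun q => τ + timeSection q
  have hΓ : ∀ q, HasFDerivAt Γ (timeSection (E := E) (F := F)) q := fun q =>
    (timeSection (E := E) (F := F)).hasFDerivAt.const_add τ
  have hΓt : ∀ q t, Γ q t = ((t : ℝ), q.1.1, q.2 t) := fun q t => by
    simp [Γ, τ, timeSection]
  have hΓs : ContDiff ℝ ∞ Γ := contDiff_const.add (timeSection (E := E) (F := F)).contDiff
  let c : F →L[ℝ] X := ContinuousLinearMap.const ℝ (Icc (0 : ℝ) 1)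
  -- Solutions with parameter x and initial value z are the fixed points of u ↦ N((x, z), u).
  let N : (E × F) × X → X := fun q => c q.1.2 + volterraIntegral F (kc.comp (Γ q))
  have hNs : ContDiff ℝ ∞ N := by
    refine ContDiff.add (c.contDiff.comp (contDiff_snd.comp contDiff_fst)) ?_
    exact (volterraIntegral F).contDiff.comp ((contDiff_continuousMap_comp kc hk).comp hΓs)
  have hN' : ∀ q, HasFDerivAt N (c ∘L (ContinuousLinearMap.snd ℝ E F) ∘L
      (ContinuousLinearMap.fst ℝ (E × F) X) + volterraIntegral F ∘L
        (ContinuousMap.clmApply _ _ _ (kc'.comp (Γ q))) ∘L timeSection) q := by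
    intro q
    refine HasFDerivAt.add ?_ ?_
    · exact (c ∘L (ContinuousLinearMap.snd ℝ E F) ∘L
        (ContinuousLinearMap.fst ℝ (E × F) X)).hasFDerivAt
    · exact (volterraIntegral F).hasFDerivAt.comp q ((hasFDerivAt_continuousMap_comp kc kc'
        (fun x => (hk.differentiable (by simp) x).hasFDerivAt) (Γ q)).comp q (hΓ q))
  have hN0 : ∀ z (u : X), N ((0, z), u) = c z := by
    intro z u
    have : kc.comp (Γ ((0, z), u)) = 0 := by
      ext t
      simp [hΓt, kc, hk0]
    simp [N, this]
  let Φ : (E × F) × X → (E × F) × X := fun q => (q.1, q.2 - N q)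
  let a : (E × F) × X := ((0, z₀), c z₀)
  have hΦs : ContDiff ℝ ∞ Φ := contDiff_fst.prodMk (contDiff_snd.sub hNs)
  -- At x = 0 the operator does not depend on u, so its partial derivative in u is zero. The
  -- derivative of Φ is then unipotent, hence invertible, on the whole interval [0, 1].
  obtain ⟨A, hA⟩ : ∃ A : E × F →L[ℝ] X, HasFDerivAt N (A ∘L ContinuousLinearMap.fst ℝ _ _) a := by
    have hd := (hNs.differentiable (by simp) a).hasFDerivAt
    refine ⟨fderiv ℝ N a ∘L ContinuousLinearMap.inl ℝ _ _, ?_⟩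
    have h2 : HasFDerivAt (fun u : X => N ((0, z₀), u))
        (fderiv ℝ N a ∘L ContinuousLinearMap.inr ℝ _ _) (c z₀) :=
      hd.comp (c z₀) (hasFDerivAt_prodMk_right (0, z₀) (c z₀))
    simp only [hN0] at h2
    have h3 := h2.unique (hasFDerivAt_const _ _)
    suffices heq : fderiv ℝ N a = (fderiv ℝ N a ∘L ContinuousLinearMap.inl ℝ _ _) ∘L
        ContinuousLinearMap.fst ℝ _ _ by rwa [heq] at hd
    refine ContinuousLinearMap.ext fun ⟨p, u⟩ => ?_
    have h4 : fderiv ℝ N a (0, u) = 0 := by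
      have := congrArg (fun L => L u) h3
      simpa using this
    have h5 : ((p, u) : (E × F) × X) = (p, 0) + (0, u) := by simp
    change fderiv ℝ N a (p, u) = fderiv ℝ N a (p, 0)
    rw [h5, map_add, h4, add_zero]
  let L : ((E × F) × X) ≃L[ℝ] ((E × F) × X) := ContinuousLinearEquiv.equivOfInverse
    ((ContinuousLinearMap.fst ℝ _ _).prod
      (ContinuousLinearMap.snd ℝ _ _ - A ∘L ContinuousLinearMap.fst ℝ _ _))
    ((ContinuousLinearMap.fst ℝ _ _).prod
      (ContinuousLinearMap.snd ℝ _ _ + A ∘L ContinuousLinearMap.fst ℝ _ _))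
    (fun q => by simp) (fun q => by simp)
  have hΦ' : HasFDerivAt Φ (L : (E × F) × X →L[ℝ] (E × F) × X) a :=
    hasFDerivAt_fst.prodMk (hasFDerivAt_snd.sub hA)
  obtain ⟨e, he, hae, hes⟩ := exists_openPartialHomeomorph_of_contDiffAt
    (Eventually.of_forall fun x => hΦs.contDiffAt) hΦ'
  have hea : e a = ((0, z₀), 0) := by
    rw [he]
    simp only [Φ, a, hN0, sub_self]
  let ι : E × F → (E × F) × X := fun p => (p, 0)
  have hι : ContDiff ℝ ∞ ι := contDiff_id.prodMk contDiff_const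
  have htgt : ∀ᶠ p in 𝓝 ((0 : E), z₀), ι p ∈ e.target := by
    refine hι.continuous.continuousAt (e.open_target.mem_nhds ?_)
    rw [show ι (0, z₀) = e a from hea.symm]
    exact e.map_source hae
  -- The solution curve is read off from the preimage of (p, 0) under Φ, where u = N(p, u).
  let U : E × F → X := fun p => (e.symm (ι p)).2
  have hUs : ∀ᶠ p in 𝓝 ((0 : E), z₀), ContDiffAt ℝ ∞ U p := by
    filter_upwards [htgt] with p hp
    have h := (hes _ (e.map_target hp)).2
    rw [← he, e.right_inv hp] at h
    exact contDiffAt_snd.comp p (h.comp p hι.contDiffAt)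
  have hUN : ∀ᶠ p in 𝓝 ((0 : E), z₀), U p = N (p, U p) := by
    filter_upwards [htgt] with p hp
    have h := e.right_inv hp
    rw [he] at h
    have h1 : (e.symm (ι p)).1 = p := congrArg Prod.fst h
    have h2 : (e.symm (ι p)).2 - N (e.symm (ι p)) = 0 := congrArg Prod.snd h
    have h3 : e.symm (ι p) = (p, U p) := Prod.ext h1 rfl
    rw [← h3]
    exact sub_eq_zero.1 h2
  refine ⟨U, hUs, ?_, ?_, ?_⟩
  · change (e.symm (ι (0, z₀))).2 = _
    rw [show ι (0, z₀) = e a from hea.symm, e.left_inv hae]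
    rfl
  · filter_upwards [hUN] with p hp t
    conv_lhs => rw [hp]
    change c p.2 t + volterraIntegral F (kc.comp (Γ (p, U p))) t = _
    rw [volterraIntegral_apply]
    congr 1
    refine intervalIntegral.integral_congr fun s hs => ?_
    rw [uIcc_of_le t.2.1] at hs
    have hs' : s ∈ Icc (0 : ℝ) 1 := ⟨hs.1, hs.2.trans t.2.2⟩
    simp only [IccExtend_of_mem zero_le_one _ hs', ContinuousMap.comp_apply, hΓt]
    rfl
  -- Differentiating U = N(·, U) gives the linearised integral equation. Its inhomogeneous term
  -- vanishes in directions that fix the initial value.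
  · filter_upwards [hUs, hUN.eventually_nhds] with p hps hpN v t
    have hd := (hps.differentiableAt (by simp)).hasFDerivAt
    have h2 := ((hN' (p, U p)).comp p (hasFDerivAt_id p |>.prodMk hd)).congr_of_eventuallyEq
      (show U =ᶠ[𝓝 p] N ∘ fun x => (id x, U x) from hpN)
    have h3 := congrArg (fun L => L (v, 0)) (hd.unique h2)
    conv_lhs => rw [h3]
    simp only [ContinuousLinearMap.comp_apply, _root_.add_apply, ContinuousLinearMap.prod_apply,
      ContinuousLinearMap.id_apply, ContinuousLinearMap.coe_fst', ContinuousLinearMap.coe_snd',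
      map_zero, zero_add]
    refine intervalIntegral.integral_congr fun s hs => ?_
    rw [uIcc_of_le t.2.1] at hs
    have hs' : s ∈ Icc (0 : ℝ) 1 := ⟨hs.1, hs.2.trans t.2.2⟩
    simp only [IccExtend_of_mem zero_le_one _ hs', ContinuousMap.comp_apply, hΓt,
      ContinuousMap.clmApply_apply]
    rfl

/-- A completely integrable total differential equation `∂ₓ G(x, z) = P(x, G(x, z))`,
`G(0, z) = z`, has a smooth solution depending smoothly on the initial value. -/
theorem exists_total_differential_solution {E F : Type u} [NormedAddCommGroup E]
    [NormedSpace ℝ E] [FiniteDimensional ℝ E] [NormedAddCommGroup F] [NormedSpace ℝ F]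
    [FiniteDimensional ℝ F] {P : E × F → E →L[ℝ] F} {z₀ : F}
    (hP : ∀ᶠ y in 𝓝 (0, z₀), ContDiffAt ℝ ∞ P y)
    (hsymm : ∀ᶠ y in 𝓝 (0, z₀), ∀ u v,
      fderiv ℝ P y (u, P y u) v = fderiv ℝ P y (v, P y v) u) :
    ∃ G : E × F → F, (∀ᶠ y in 𝓝 (0, z₀), ContDiffAt ℝ ∞ G y) ∧
      (∀ᶠ z in 𝓝 z₀, G (0, z) = z) ∧
      ∀ᶠ y in 𝓝 (0, z₀), ∀ v, fderiv ℝ G y (v, 0) = P (y.1, G y) v := by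
  have : CompleteSpace E := FiniteDimensional.complete ℝ E
  have : CompleteSpace F := FiniteDimensional.complete ℝ F
  obtain ⟨Q, hQ, hQP⟩ := exists_contDiff_eventuallyEq hP
  have hgood : ∀ᶠ y in 𝓝 ((0 : E), z₀), Q y = P y ∧ ∀ u v,
      fderiv ℝ Q y (u, Q y u) v = fderiv ℝ Q y (v, Q y v) u := by
    filter_upwards [hQP.eventuallyEq_nhds, hsymm] with y h1 h2
    refine ⟨h1.self_of_nhds, ?_⟩
    rw [h1.fderiv_eq, h1.self_of_nhds]
    exact h2
  obtain ⟨r, hr, hball⟩ := Metric.eventually_nhds_iff_ball.1 hgood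
  -- Along the ray t ↦ tx the equation becomes u' = Q(tx, u) x, which is switched off at x = 0. The
  -- solution at time 1 is G(x, z).
  let k : ℝ × E × F → F := fun q => Q (q.1 • q.2.1, q.2.2) q.2.1
  have hk : ContDiff ℝ ∞ k := by
    refine ContDiff.clm_apply (hQ.comp ?_) ?_
    · fun_prop
    · fun_prop
  have hk' : ∀ t x z v ζ, fderiv ℝ k (t, x, z) (0, v, ζ) =
      fderiv ℝ Q (t • x, z) (t • v, ζ) x + Q (t • x, z) v := by
    intro t x z v ζ
    have h1 : HasFDerivAt (fun q : ℝ × E × F => (q.1 • q.2.1, q.2.2)) _ (t, x, z) :=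
      ((hasFDerivAt_fst (𝕜 := ℝ) (p := (t, x, z))).smul
        ((hasFDerivAt_fst (𝕜 := ℝ) (p := (x, z))).comp (t, x, z) hasFDerivAt_snd)).prodMk
        ((hasFDerivAt_snd (𝕜 := ℝ) (p := (x, z))).comp (t, x, z) hasFDerivAt_snd)
    have h2 := ((hQ.differentiable (by simp) (t • x, z)).hasFDerivAt.comp (t, x, z) h1).clm_apply
      ((hasFDerivAt_fst (𝕜 := ℝ) (p := (x, z))).comp (t, x, z) hasFDerivAt_snd)
    have h3 : fderiv ℝ k (t, x, z) = _ := h2.fderiv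
    rw [h3]
    simp [add_comm]
  obtain ⟨U, hUs, hU0, hU, hU'⟩ := exists_parametric_integral_solution hk
    (fun t z => by simp [k]) z₀
  let one : Icc (0 : ℝ) 1 := ⟨1, by simp⟩
  let ev : C(Icc (0 : ℝ) 1, F) →L[ℝ] F := ContinuousMap.evalCLM ℝ one
  have hev : ∀ u, ev u = u one := fun u => rfl
  refine ⟨fun p => ev (U p), ?_, ?_, ?_⟩
  · filter_upwards [hUs] with p hp
    exact ev.contDiff.contDiffAt.comp p hp
  · have h : Tendsto (fun z => ((0 : E), z)) (𝓝 z₀) (𝓝 (0, z₀)) :=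
      (Continuous.prodMk_right (0 : E)).tendsto z₀
    filter_upwards [h.eventually hU] with z hz
    rw [hev, hz one]
    simp [k]
  · have hclose : ∀ᶠ p in 𝓝 ((0 : E), z₀), ‖p.1‖ < r ∧ dist (U p) (ContinuousMap.const _ z₀) < r := by
      have h1 : ContinuousAt U (0, z₀) := hUs.self_of_nhds.continuousAt
      have h2 := h1 (Metric.ball_mem_nhds _ hr)
      rw [hU0] at h2
      have h3 : ∀ᶠ p in 𝓝 ((0 : E), z₀), ‖p.1‖ < r := by
        have : ContinuousAt (fun p : E × F => ‖p.1‖) (0, z₀) := by fun_prop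
        exact this.eventually_lt continuousAt_const (by simpa using hr)
      filter_upwards [h3, h2] with p hp hp'
      exact ⟨hp, hp'⟩
    filter_upwards [hUs, hU, hU', hclose] with p hps hp hp' hpc v
    set x := p.1 with hx
    set u : ℝ → F := IccExtend zero_le_one (U p) with hu
    set D := fderiv ℝ U p (v, 0) with hD
    set d : ℝ → F := IccExtend zero_le_one D with hd
    have huc : Continuous u := (U p).continuous.Icc_extend'
    have hdc : Continuous d := D.continuous.Icc_extend'
    have hmem : ∀ t ∈ Icc (0 : ℝ) 1, (t • x, u t) ∈ Metric.ball ((0 : E), z₀) r := by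
      intro t ht
      rw [mem_ball_iff_norm, Prod.mk_sub_mk, Prod.norm_def, max_lt_iff]
      constructor
      · rw [sub_zero, norm_smul, Real.norm_of_nonneg ht.1]
        exact (mul_le_of_le_one_left (norm_nonneg _) ht.2).trans_lt hpc.1
      · rw [hu, IccExtend_of_mem zero_le_one _ ht, ← dist_eq_norm]
        exact (ContinuousMap.dist_apply_le_dist (⟨t, ht⟩ : Icc (0 : ℝ) 1)).trans_lt hpc.2
    have hu' : ∀ t ∈ Icc (0 : ℝ) 1, u t = p.2 + ∫ s in (0 : ℝ)..t, k (s, x, u s) := by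
      intro t ht
      rw [hu, IccExtend_of_mem zero_le_one _ ht]
      exact hp ⟨t, ht⟩
    have hd' : ∀ t ∈ Icc (0 : ℝ) 1,
        d t = ∫ s in (0 : ℝ)..t, fderiv ℝ k (s, x, u s) (0, v, d s) := by
      intro t ht
      rw [hd, IccExtend_of_mem zero_le_one _ ht]
      exact hp' v ⟨t, ht⟩
    obtain ⟨u₁, hu₁, hut⟩ : ∃ u₁ : ℝ → F, (∀ t, HasDerivAt u₁ (k (t, x, u t)) t) ∧
        ∀ t ∈ Icc (0 : ℝ) 1, u₁ t = u t := by
      refine ⟨fun t => p.2 + ∫ s in (0 : ℝ)..t, k (s, x, u s), fun t => ?_,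
        fun t ht => (hu' t ht).symm⟩
      have hc : Continuous fun s => k (s, x, u s) := hk.continuous.comp (by fun_prop)
      exact (intervalIntegral.integral_hasDerivAt_right (hc.intervalIntegrable _ _)
        (hc.stronglyMeasurableAtFilter _ _) hc.continuousAt).const_add p.2
    obtain ⟨d₁, hd₁, hdt⟩ : ∃ d₁ : ℝ → F,
        (∀ t, HasDerivAt d₁ (fderiv ℝ k (t, x, u t) (0, v, d t)) t) ∧
        ∀ t ∈ Icc (0 : ℝ) 1, d₁ t = d t := by
      refine ⟨fun t => ∫ s in (0 : ℝ)..t, fderiv ℝ k (s, x, u s) (0, v, d s), fun t => ?_,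
        fun t ht => (hd' t ht).symm⟩
      have hc : Continuous fun s => fderiv ℝ k (s, x, u s) (0, v, d s) := by
        have := hk.continuous_fderiv (by simp)
        exact (this.comp (by fun_prop : Continuous fun s => (s, x, u s))).clm_apply (by fun_prop)
      exact intervalIntegral.integral_hasDerivAt_right (hc.intervalIntegrable _ _)
        (hc.stronglyMeasurableAtFilter _ _) hc.continuousAt
    -- The expected variation of u in the direction v is t Q(tx, u) v, and w measures the deviation
    -- from it. The integrability condition makes w solve a homogeneous linear equation with w(0) =
    -- 0.
    let w : ℝ → F := fun t => d₁ t - t • Q (t • x, u₁ t) v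
    have hw : ∀ t ∈ Icc (0 : ℝ) 1, HasDerivAt w (fderiv ℝ Q (t • x, u t) (0, w t) x) t := by
      intro t ht
      have h1 : HasDerivAt (fun s => (s • x, u₁ s)) (x, k (t, x, u t)) t := by
        simpa using ((hasDerivAt_id t).smul_const x).prodMk (hu₁ t)
      have h2 : HasDerivAt (fun s => Q (s • x, u₁ s) v)
          (fderiv ℝ Q (t • x, u₁ t) (x, k (t, x, u t)) v) t := by
        have hQd : HasFDerivAt Q (fderiv ℝ Q (t • x, u₁ t)) (t • x, u₁ t) :=
          (hQ.differentiable (by simp) _).hasFDerivAt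
        exact (ContinuousLinearMap.apply ℝ F v).hasFDerivAt.comp_hasDerivAt t
          (hQd.comp_hasDerivAt t h1)
      have h3 := (hd₁ t).sub ((hasDerivAt_id t).smul h2)
      refine h3.congr_deriv ?_
      have hs := (hball _ (hmem t ht)).2 x v
      simp only [w, hut t ht, hdt t ht, hk', id, one_smul]
      simp only [k]
      have e1 : ((0 : E), d t - t • Q (t • x, u t) v) =
          (t • v, d t) - t • (v, Q (t • x, u t) v) := by
        ext <;> simp
      rw [hs, e1, map_sub, map_smul]
      simp only [_root_.sub_apply, _root_.smul_apply]
      abel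
    let A : ℝ → F →L[ℝ] F := fun t => ContinuousLinearMap.apply ℝ F x ∘L
      fderiv ℝ Q (t • x, u t) ∘L ContinuousLinearMap.inr ℝ E F
    obtain ⟨K, hK⟩ : ∃ K, ∀ t ∈ Icc (0 : ℝ) 1, ‖A t‖ ≤ K := by
      have hc : Continuous fun t => fderiv ℝ Q (t • x, u t) :=
        (hQ.continuous_fderiv (by simp)).comp (by fun_prop)
      have hA : Continuous A := continuous_const.clm_comp (hc.clm_comp continuous_const)
      exact isCompact_Icc.exists_bound_of_continuousOn hA.continuousOn
    -- Uniqueness of Grönwall type gives w(1) = 0, which is the required formula for ∂ₓG.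
    have hzero := eq_zero_of_abs_deriv_le_mul_abs_self_of_eq_zero_right (f := w) (K := K)
      (a := 0) (b := 1) (fun t ht => (hw t ht).continuousAt.continuousWithinAt)
      (fun t ht => (hw t ⟨ht.1, ht.2.le⟩).hasDerivWithinAt) (by simp [w, hdt 0, hd' 0])
      (fun t ht => ((A t).le_opNorm (w t)).trans
        (mul_le_mul_of_nonneg_right (hK t ⟨ht.1, ht.2.le⟩) (norm_nonneg _))) 1 (by simp)
    have h11 : (1 : ℝ) ∈ Icc (0 : ℝ) 1 := by simp
    have hG : fderiv ℝ (fun p => ev (U p)) p (v, 0) = d 1 := by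
      have := (ev.hasFDerivAt.comp p (hps.differentiableAt (by simp)).hasFDerivAt).fderiv
      have h2 : fderiv ℝ (fun p => ev (U p)) p = ev ∘L fderiv ℝ U p := this
      rw [h2, hd, IccExtend_of_mem zero_le_one _ h11]
      rfl
    have hu1 : ev (U p) = u 1 := by
      rw [hu, IccExtend_of_mem zero_le_one _ h11]
      rfl
    simp only [w, hdt 1 h11, hut 1 h11, one_smul] at hzero
    rw [hG, hu1, sub_eq_zero.1 hzero]
    have h5 := (hball _ (hmem 1 h11)).1
    rw [one_smul] at h5
    rw [h5]

end TotalDifferential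

/-! ### Integrable one-forms and relative primitives -/

section IntegrableOneForm

/-- Frobenius' theorem for a one-form `α` with `dα = 0` on `ker α`, together with a relative
Poincaré lemma: `α = h dz`, and a one-form `β` with `dβ = 0` on `ker α` is there equal to `df`. -/
theorem exists_integrating_factor_and_primitive {E : Type} [NormedAddCommGroup E]
    [NormedSpace ℝ E] [FiniteDimensional ℝ E] {α β : E → E →L[ℝ] ℝ} {y₀ n₀ : E}
    (hα : ∀ᶠ y in 𝓝 y₀, ContDiffAt ℝ ∞ α y) (hβ : ∀ᶠ y in 𝓝 y₀, ContDiffAt ℝ ∞ β y)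
    (hn : α y₀ n₀ = 1)
    (hdα : ∀ᶠ y in 𝓝 y₀, ∀ u v, α y u = 0 → α y v = 0 → fderiv ℝ α y u v = fderiv ℝ α y v u)
    (hdβ : ∀ᶠ y in 𝓝 y₀, ∀ u v, α y u = 0 → α y v = 0 → fderiv ℝ β y u v = fderiv ℝ β y v u) :
    ∃ z h f : E → ℝ, ∀ᶠ y in 𝓝 y₀, ContDiffAt ℝ ∞ z y ∧ ContDiffAt ℝ ∞ h y ∧
      ContDiffAt ℝ ∞ f y ∧ 0 < h y ∧ (∀ v, α y v = h y * fderiv ℝ z y v) ∧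
      ∀ v, α y v = 0 → fderiv ℝ f y v = β y v := by
  have : CompleteSpace E := FiniteDimensional.complete ℝ E
  set a := α y₀ with ha
  -- Near y₀ the plane ker α y is a graph over ker a, with slope p in the direction n₀, and L lifts
  -- to it. Working on all of E, with n₀ projected away, avoids a separate model for ker a.
  let pr : E →L[ℝ] E := ContinuousLinearMap.id ℝ E - a.smulRight n₀
  have hpr : ∀ v, pr v = v - a v • n₀ := fun v => rfl
  let p : E → E →L[ℝ] ℝ := fun y => -((α y n₀)⁻¹ • (α y ∘L pr))
  let L : E → E →L[ℝ] E := fun y => pr + (p y).smulRight n₀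
  let q : E → E →L[ℝ] ℝ := fun y => β y ∘L L y
  let R : E → E →L[ℝ] ℝ × ℝ := fun y => (p y).prod (q y)
  have hLv : ∀ y v, L y v = pr v + p y v • n₀ := fun y v => rfl
  have hne : ∀ᶠ y in 𝓝 y₀, α y n₀ ≠ 0 := by
    have hc : ContinuousAt (fun y => α y n₀) y₀ :=
      hα.self_of_nhds.continuousAt.clm_apply continuousAt_const
    exact hc.eventually_ne (by rw [hn]; exact one_ne_zero)
  have hαL : ∀ y, α y n₀ ≠ 0 → ∀ v, α y (L y v) = 0 := by
    intro y hy v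
    rw [hLv, map_add, map_smul]
    simp only [p, _root_.neg_apply, _root_.smul_apply, ContinuousLinearMap.comp_apply, smul_eq_mul]
    field_simp
    ring
  have hps : ∀ᶠ y in 𝓝 y₀, ContDiffAt ℝ ∞ p y := by
    filter_upwards [hα, hne] with y hy hy'
    exact (((hy.clm_apply contDiffAt_const).inv hy').smul (hy.clm_comp contDiffAt_const)).neg
  have hLs : ∀ᶠ y in 𝓝 y₀, ContDiffAt ℝ ∞ L y := by
    filter_upwards [hps] with y hy
    exact contDiffAt_const.add (hy.smulRight contDiffAt_const)
  have hqs : ∀ᶠ y in 𝓝 y₀, ContDiffAt ℝ ∞ q y := by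
    filter_upwards [hβ, hLs] with y hy hy'
    exact hy.clm_comp hy'
  have hRs : ∀ᶠ y in 𝓝 y₀, ContDiffAt ℝ ∞ R y := by
    filter_upwards [hps, hqs] with y hy hy'
    have hR : R = fun y => ContinuousLinearMap.inl ℝ ℝ ℝ ∘L p y +
        ContinuousLinearMap.inr ℝ ℝ ℝ ∘L q y := by
      funext y
      ext v <;> simp [R]
    rw [hR]
    exact (contDiffAt_const.clm_comp hy).add (contDiffAt_const.clm_comp hy')
  -- The first component of this condition is dα = 0 on ker α, obtained by differentiating α(Lt) =
  -- 0. The second is dβ = 0 on ker α, up to a term in dp that is already symmetric.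
  have hRsymm : ∀ᶠ y in 𝓝 y₀, ∀ u v, fderiv ℝ R y (L y u) v = fderiv ℝ R y (L y v) u := by
    filter_upwards [hα, hβ, hne, hne.eventually_nhds, hps, hLs, hqs, hRs, hdα, hdβ]
      with y hαy hβy hney hney' hpy hLy hqy hRy hdαy hdβy u v
    have hdR : ∀ w t, fderiv ℝ R y w t = (fderiv ℝ p y w t, fderiv ℝ q y w t) := by
      intro w t
      have h1 : fderiv ℝ (fun y => R y t) y w = fderiv ℝ R y w t := by
        rw [fderiv_clm_apply (hRy.differentiableAt (by simp)) (by fun_prop)]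
        simp
      have h2 : fderiv ℝ (fun y => p y t) y w = fderiv ℝ p y w t := by
        rw [fderiv_clm_apply (hpy.differentiableAt (by simp)) (by fun_prop)]
        simp
      have h3 : fderiv ℝ (fun y => q y t) y w = fderiv ℝ q y w t := by
        rw [fderiv_clm_apply (hqy.differentiableAt (by simp)) (by fun_prop)]
        simp
      have hpd : DifferentiableAt ℝ (fun y => p y t) y :=
        (hpy.differentiableAt (by simp)).clm_apply (by fun_prop)
      have hqd : DifferentiableAt ℝ (fun y => q y t) y :=
        (hqy.differentiableAt (by simp)).clm_apply (by fun_prop)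
      rw [← h1, ← h2, ← h3]
      have : fderiv ℝ (fun y => (p y t, q y t)) y = _ := hpd.fderiv_prodMk hqd
      change fderiv ℝ (fun y => (p y t, q y t)) y w = _
      rw [this]
      rfl
    have hdL : ∀ t, HasFDerivAt (fun y => L y t) ((fderiv ℝ p y).flip t |>.smulRight n₀) y := by
      intro t
      have h1 := (hpy.differentiableAt (by simp)).hasFDerivAt
      have h2 := ((ContinuousLinearMap.apply ℝ ℝ t).hasFDerivAt.comp y h1).smul_const n₀
      exact h2.const_add (pr t)
    have hdγ : ∀ (γ : E → E →L[ℝ] ℝ), ContDiffAt ℝ ∞ γ y → ∀ w t,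
        fderiv ℝ (fun y => γ y (L y t)) y w =
          fderiv ℝ γ y w (L y t) + fderiv ℝ p y w t * γ y n₀ := by
      intro γ hγ w t
      have h := (((hγ.differentiableAt (by simp)).hasFDerivAt).clm_apply (hdL t)).fderiv
      rw [h]
      simp [add_comm]
    have hp' : ∀ w t, fderiv ℝ α y w (L y t) + fderiv ℝ p y w t * α y n₀ = 0 := by
      intro w t
      have h0 : (fun y => α y (L y t)) =ᶠ[𝓝 y] fun _ => 0 := by
        filter_upwards [hney'] with x hx using hαL x hx t
      rw [← hdγ α hαy, h0.fderiv_eq]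
      simp
    have hq' : ∀ w t, fderiv ℝ q y w t =
        fderiv ℝ β y w (L y t) + fderiv ℝ p y w t * β y n₀ := by
      intro w t
      rw [← hdγ β hβy]
      have h3 : fderiv ℝ (fun y => q y t) y w = fderiv ℝ q y w t := by
        rw [fderiv_clm_apply (hqy.differentiableAt (by simp)) (by fun_prop)]
        simp
      rw [← h3]
      rfl
    have hp'' : fderiv ℝ p y (L y u) v = fderiv ℝ p y (L y v) u := by
      have h1 := hp' (L y u) v
      have h2 := hp' (L y v) u
      rw [hdαy _ _ (hαL y hney u) (hαL y hney v)] at h1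
      exact mul_right_cancel₀ hney (by linarith)
    rw [hdR, hdR, hq', hq', hp'', hdβy _ _ (hαL y hney u) (hαL y hney v)]
  -- The unknown (r, s) consists of the height r of the leaf over x and the primitive s of β along
  -- it. The equations do not involve s on the right.
  let Y' : E × (ℝ × ℝ) →L[ℝ] E := pr ∘L ContinuousLinearMap.fst ℝ _ _ +
    (ContinuousLinearMap.fst ℝ ℝ ℝ ∘L ContinuousLinearMap.snd ℝ _ _).smulRight n₀
  let Y : E × (ℝ × ℝ) → E := fun x => y₀ + Y' x
  have hY' : ∀ x r s, Y' (x, (r, s)) = pr x + r • n₀ := fun x r s => rfl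
  have hYd : ∀ x, HasFDerivAt Y Y' x := fun x => Y'.hasFDerivAt.const_add y₀
  have hYs : ContDiff ℝ ∞ Y := contDiff_const.add Y'.contDiff
  have hY0 : Y (0, 0) = y₀ := by
    change y₀ + Y' 0 = y₀
    rw [map_zero, add_zero]
  have hYt : Tendsto Y (𝓝 (0, 0)) (𝓝 y₀) := by
    have := hYs.continuous.tendsto (0, 0)
    rwa [hY0] at this
  obtain ⟨G, hGs, hG0, hG'⟩ := exists_total_differential_solution (P := fun x => R (Y x))
    (z₀ := (0 : ℝ × ℝ))
    (by
      filter_upwards [hYt.eventually hRs] with x hx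
      exact hx.comp x hYs.contDiffAt)
    (by
      filter_upwards [hYt.eventually hRs, hYt.eventually hRsymm] with x hx hx' u v
      have h1 : fderiv ℝ (fun x => R (Y x)) x = fderiv ℝ R (Y x) ∘L Y' :=
        ((hx.differentiableAt (by simp)).hasFDerivAt.comp x (hYd x)).fderiv
      rw [h1]
      exact hx' u v)
  -- A point y selects the leaf of initial height a(y - y₀), and the primitive starts at 0 on the
  -- transversal.
  let g' : E →L[ℝ] E × (ℝ × ℝ) := (ContinuousLinearMap.id ℝ E).prod (a.prod 0)
  let g : E → E × (ℝ × ℝ) := fun y => g' (y - y₀)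
  have hg' : ∀ v, g' v = (v, (a v, 0)) := fun v => rfl
  have hgd : ∀ y, HasFDerivAt g g' y := fun y =>
    g'.hasFDerivAt.comp y ((hasFDerivAt_id y).sub_const y₀)
  have hgs : ContDiff ℝ ∞ g := g'.contDiff.comp (contDiff_id.sub contDiff_const)
  have hg0 : g y₀ = (0, 0) := by
    change g' (y₀ - y₀) = 0
    rw [sub_self, map_zero]
  have hgt : Tendsto g (𝓝 y₀) (𝓝 (0, 0)) := by
    have := hgs.continuous.tendsto y₀
    rwa [hg0] at this
  let m : E → ℝ × ℝ := fun y => fderiv ℝ G (g y) (0, (1, 0))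
  -- C carries the planes parallel to ker a onto the leaves of ker α. Its derivative at y₀ is the
  -- identity, so it has a smooth local inverse.
  let C : E → E := fun y => Y (y - y₀, G (g y))
  have hC : ∀ y, C y = y₀ + (pr (y - y₀) + (G (g y)).1 • n₀) := fun y => rfl
  have hG00 : G (0, 0) = 0 := hG0.self_of_nhds
  have hC0 : C y₀ = y₀ := by
    rw [hC, hg0, hG00]
    simp
  have hGg : ∀ᶠ y in 𝓝 y₀, HasFDerivAt (fun y => G (g y)) (fderiv ℝ G (g y) ∘L g') y ∧
      ∀ v, fderiv ℝ G (g y) (g' v) = R (C y) v + a v • m y := by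
    filter_upwards [hgt.eventually hGs, hgt.eventually hG'] with y hy hy'
    refine ⟨(hy.differentiableAt (by simp)).hasFDerivAt.comp y (hgd y), fun v => ?_⟩
    have e1 : g' v = (v, 0) + a v • ((0 : E), ((1 : ℝ), (0 : ℝ))) := by
      rw [hg']; ext <;> simp
    rw [e1, map_add, map_smul, hy']
    rfl
  have hCs : ∀ᶠ y in 𝓝 y₀, ContDiffAt ℝ ∞ C y := by
    filter_upwards [hgt.eventually hGs] with y hy
    exact hYs.contDiffAt.comp y
      ((contDiffAt_id.sub contDiffAt_const).prodMk (hy.comp y hgs.contDiffAt))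
  have hCd : ∀ᶠ y in 𝓝 y₀, ∀ v, fderiv ℝ C y v = L (C y) v + (a v * (m y).1) • n₀ := by
    filter_upwards [hGg] with y hy v
    have h1 := (hYd (y - y₀, G (g y))).comp y
      (((hasFDerivAt_id y).sub_const y₀).prodMk hy.1)
    have h2 : fderiv ℝ C y = _ := h1.fderiv
    have h3 : fderiv ℝ C y v = pr v + (fderiv ℝ G (g y) (g' v)).1 • n₀ := by rw [h2]; rfl
    rw [h3, hy.2 v, hLv, add_assoc, ← add_smul]
    rfl
  have hm0 : m y₀ = (1, 0) := by
    have h1 : HasFDerivAt G (fderiv ℝ G (0, 0)) ((0 : E), (0 : ℝ × ℝ)) :=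
      (hGs.self_of_nhds.differentiableAt (by simp)).hasFDerivAt
    have h2 := h1.comp (0 : ℝ × ℝ) (hasFDerivAt_prodMk_right (0 : E) (0 : ℝ × ℝ))
    have h3 := h2.unique ((hasFDerivAt_id (𝕜 := ℝ) (0 : ℝ × ℝ)).congr_of_eventuallyEq hG0)
    have h4 := congrArg (fun T => T ((1 : ℝ), (0 : ℝ))) h3
    simpa [m, hg0] using h4
  have hCd0 : HasFDerivAt C ((ContinuousLinearEquiv.refl ℝ E : E ≃L[ℝ] E) : E →L[ℝ] E) y₀ := by
    have h1 := (hCs.self_of_nhds.differentiableAt (by simp)).hasFDerivAt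
    refine h1.congr_fderiv (ContinuousLinearMap.ext fun v => ?_)
    rw [hCd.self_of_nhds, hC0, hm0, hLv, hpr]
    have : p y₀ v = 0 := by
      simp [p, hpr, ← ha, hn]
    simp [this]
  obtain ⟨e, he, hye, hes⟩ := exists_openPartialHomeomorph_of_contDiffAt hCs hCd0
  have hsymm0 : e.symm y₀ = y₀ := by
    conv_lhs => rw [← hC0, ← he]
    exact e.left_inv hye
  have htgt : ∀ᶠ y in 𝓝 y₀, y ∈ e.target := by
    refine e.open_target.mem_nhds ?_
    have := e.map_source hye
    rwa [he, hC0] at this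
  have hcs : ∀ᶠ y in 𝓝 y₀, ContDiffAt ℝ ∞ e.symm y ∧ C (e.symm y) = y := by
    filter_upwards [htgt] with y hy
    have h := (hes _ (e.map_target hy)).2
    have h1 : C (e.symm y) = y := by rw [← he]; exact e.right_inv hy
    rw [h1] at h
    exact ⟨h, h1⟩
  have hct : Tendsto e.symm (𝓝 y₀) (𝓝 y₀) := by
    have : Tendsto e.symm (𝓝 y₀) (𝓝 (e.symm y₀)) := hcs.self_of_nhds.1.continuousAt
    rwa [hsymm0] at this
  have hms : ∀ᶠ y in 𝓝 y₀, ContDiffAt ℝ ∞ m y := by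
    filter_upwards [hgt.eventually hGs] with y hy
    have h1 : ContDiffAt ℝ ∞ (fderiv ℝ G) (g y) := hy.fderiv_right (by simp)
    exact (h1.comp y hgs.contDiffAt).clm_apply contDiffAt_const
  have hhs : ∀ᶠ y in 𝓝 y₀, ContDiffAt ℝ ∞ (fun y => (m (e.symm y)).1 * α y n₀) y := by
    filter_upwards [hct.eventually hms, hcs, hα] with y hy hy' hy''
    exact (contDiffAt_fst.comp y (hy.comp y hy'.1)).mul (hy''.clm_apply contDiffAt_const)
  have hpos : ∀ᶠ y in 𝓝 y₀, 0 < (m (e.symm y)).1 * α y n₀ := by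
    refine continuousAt_const.eventually_lt hhs.self_of_nhds.continuousAt ?_
    rw [hsymm0, hm0, ← ha, hn]
    norm_num
  -- After the leaves are straightened by C⁻¹, z is the leaf label and f is the value of s. The
  -- factor h is α(n₀) times the derivative of the leaf height in its initial value, which equals 1
  -- at y₀.
  refine ⟨fun y => a (e.symm y), fun y => (m (e.symm y)).1 * α y n₀,
    fun y => (G (g (e.symm y))).2, ?_⟩
  filter_upwards [hcs, hcs.eventually_nhds, hhs, hpos, hct.eventually (hgt.eventually hGs),
    hct.eventually hGg, hct.eventually hCd, hct.eventually hCs, hne]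
    with y hcy hcy' hhy hposy hGy hGgy hCdy hCsy hney
  have hcd := (hcy.1.differentiableAt (by simp)).hasFDerivAt
  have hv : ∀ v, v = L y (fderiv ℝ e.symm y v) +
      (a (fderiv ℝ e.symm y v) * (m (e.symm y)).1) • n₀ := by
    intro v
    have h1 := (hCsy.differentiableAt (by simp)).hasFDerivAt.comp y hcd
    have h2 : (C ∘ e.symm) =ᶠ[𝓝 y] id := hcy'.mono fun x hx => hx.2
    have h3 := h1.unique ((hasFDerivAt_id y).congr_of_eventuallyEq h2)
    have h4 := congrArg (fun T => T v) h3
    simp only [ContinuousLinearMap.comp_apply, hCdy, hcy.2] at h4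
    exact h4.symm
  have hz : ∀ v, fderiv ℝ (fun y => a (e.symm y)) y v = a (fderiv ℝ e.symm y v) := by
    intro v
    have : fderiv ℝ (fun y => a (e.symm y)) y = _ := (a.hasFDerivAt.comp y hcd).fderiv
    rw [this]
    rfl
  have hαz : ∀ v, α y v = (m (e.symm y)).1 * α y n₀ * fderiv ℝ (fun y => a (e.symm y)) y v := by
    intro v
    rw [hz]
    conv_lhs => rw [hv v]
    rw [map_add, map_smul, hαL y hney, smul_eq_mul]
    ring
  refine ⟨a.contDiff.contDiffAt.comp y hcy.1, hhy, ?_, hposy, hαz, ?_⟩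
  · exact contDiffAt_snd.comp y (hGy.comp y (hgs.contDiffAt.comp y hcy.1))
  · intro v hv0
    have haw : a (fderiv ℝ e.symm y v) = 0 := by
      have h := hαz v
      rw [hv0, hz] at h
      exact (mul_eq_zero.1 h.symm).resolve_left hposy.ne'
    have h1 := (ContinuousLinearMap.snd ℝ ℝ ℝ).hasFDerivAt.comp y (hGgy.1.comp y hcd)
    have h2 : fderiv ℝ (fun y => (G (g (e.symm y))).2) y = _ := h1.fderiv
    have h3 : fderiv ℝ (fun y => (G (g (e.symm y))).2) y v =
        (fderiv ℝ G (g (e.symm y)) (g' (fderiv ℝ e.symm y v))).2 := by rw [h2]; rfl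
    rw [h3, hGgy.2, haw, zero_smul, add_zero, hcy.2]
    conv_rhs => rw [hv v, haw]
    rw [zero_mul, zero_smul, add_zero]
    rfl

end IntegrableOneForm

/-! ### The structure `J` in local coordinates -/

section Flat

/-- The product rule produces two second-derivative terms of f, which cancel by symmetry. This moves
brackets into the coordinates F without transporting the vector fields. -/
theorem fderiv_lieBracket_apply {E F : Type*} [NormedAddCommGroup E] [NormedSpace ℝ E]
    [NormedAddCommGroup F] [NormedSpace ℝ F] {f : E → F} {x : E} (hf : ContDiffAt ℝ ∞ f x)
    {U V : E → E} (hU : DifferentiableAt ℝ U x) (hV : DifferentiableAt ℝ V x) :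
    fderiv ℝ f x (VectorField.lieBracket ℝ U V x) =
      fderiv ℝ (fun y => fderiv ℝ f y (V y)) x (U x) -
        fderiv ℝ (fun y => fderiv ℝ f y (U y)) x (V x) := by
  have hd : DifferentiableAt ℝ (fderiv ℝ f) x :=
    (hf.fderiv_right (m := ∞) (by simp)).differentiableAt (by simp)
  have hs : IsSymmSndFDerivAt ℝ f x := hf.isSymmSndFDerivAt (by
    rw [minSmoothness_of_isRCLikeNormedField]
    exact WithTop.coe_le_coe.2 (le_top : (2 : ℕ∞) ≤ ⊤))
  rw [fderiv_clm_apply hd hU, fderiv_clm_apply hd hV, VectorField.lieBracket, map_sub]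
  simp only [_root_.add_apply, ContinuousLinearMap.comp_apply, ContinuousLinearMap.flip_apply]
  rw [hs.eq (U x) (V x)]
  abel

/-- If `J(v, c) = (φ v + c ξ, α v)` has constant coefficients in some coordinate system, then
`φ` is invariant under `ξ`. -/
theorem lieBracket_eq_of_constant_coefficients {E W : Type*} [NormedAddCommGroup E]
    [NormedSpace ℝ E] [NormedAddCommGroup W] [NormedSpace ℝ W]
    {ξ : E → E} {φ : E → E →L[ℝ] E} {α : E → E →L[ℝ] ℝ} {x : E × ℝ} {F : E × ℝ → W}
    (hF : ContDiffAt ℝ ∞ F x) (hinj : Function.Injective (fderiv ℝ F x)) (A : W →L[ℝ] W)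
    (hJ : ∀ᶠ y in 𝓝 x, ∀ (v : E) (c : ℝ),
      fderiv ℝ F y (φ y.1 v + c • ξ y.1, α y.1 v) = A (fderiv ℝ F y (v, c)))
    (hξ : DifferentiableAt ℝ ξ x.1) (hφ : DifferentiableAt ℝ φ x.1)
    (hα : DifferentiableAt ℝ α x.1) {X : E → E} (hX : DifferentiableAt ℝ X x.1) :
    VectorField.lieBracket ℝ ξ (fun y => φ y (X y)) x.1 =
      φ x.1 (VectorField.lieBracket ℝ ξ X x.1) := by
  have hfst : DifferentiableAt ℝ (Prod.fst : E × ℝ → E) x := differentiableAt_fst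
  -- The Nijenhuis identity is tested on V = X and T = ∂_q. The brackets [V, T] and [JV, T] vanish
  -- because these fields do not depend on q.
  let V : E × ℝ → E × ℝ := fun y => (X y.1, 0)
  let T : E × ℝ → E × ℝ := fun _ => (0, 1)
  let JV : E × ℝ → E × ℝ := fun y => (φ y.1 (X y.1), α y.1 (X y.1))
  let JT : E × ℝ → E × ℝ := fun y => (ξ y.1, 0)
  have hφX : DifferentiableAt ℝ (fun y => φ y (X y)) x.1 := hφ.clm_apply hX
  have hαX : DifferentiableAt ℝ (fun y => α y (X y)) x.1 := hα.clm_apply hX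
  have dV : HasFDerivAt V ((fderiv ℝ X x.1 ∘L ContinuousLinearMap.fst ℝ E ℝ).prod 0) x :=
    (hX.hasFDerivAt.comp x hasFDerivAt_fst).prodMk (hasFDerivAt_const _ _)
  have dT : HasFDerivAt T (0 : E × ℝ →L[ℝ] E × ℝ) x := hasFDerivAt_const _ _
  have dJT : HasFDerivAt JT ((fderiv ℝ ξ x.1 ∘L ContinuousLinearMap.fst ℝ E ℝ).prod 0) x :=
    (hξ.hasFDerivAt.comp x hasFDerivAt_fst).prodMk (hasFDerivAt_const _ _)
  have dJV : HasFDerivAt JV ((fderiv ℝ (fun y => φ y (X y)) x.1 ∘L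
      ContinuousLinearMap.fst ℝ E ℝ).prod
      (fderiv ℝ (fun y => α y (X y)) x.1 ∘L ContinuousLinearMap.fst ℝ E ℝ)) x :=
    (hφX.hasFDerivAt.comp x hasFDerivAt_fst).prodMk (hαX.hasFDerivAt.comp x hasFDerivAt_fst)
  have hd : DifferentiableAt ℝ (fderiv ℝ F) x :=
    (hF.fderiv_right (m := ∞) (by simp)).differentiableAt (by simp)
  have hA : ∀ {S JS : E × ℝ → E × ℝ}, DifferentiableAt ℝ S x →
      (∀ᶠ y in 𝓝 x, fderiv ℝ F y (JS y) = A (fderiv ℝ F y (S y))) →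
      ∀ w, fderiv ℝ (fun y => fderiv ℝ F y (JS y)) x w =
        A (fderiv ℝ (fun y => fderiv ℝ F y (S y)) x w) := by
    intro S JS hS h w
    have h1 : HasFDerivAt (fun y => fderiv ℝ F y (S y)) _ x := (hd.clm_apply hS).hasFDerivAt
    have h2 := (A.hasFDerivAt.comp x h1).fderiv
    have h3 : (fun y => fderiv ℝ F y (JS y)) =ᶠ[𝓝 x] A ∘ fun y => fderiv ℝ F y (S y) := h
    rw [h3.fderiv_eq, h2]
    rfl
  have hAV := hA dV.differentiableAt (JS := JV) (by
    filter_upwards [hJ] with y hy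
    simpa [JV, V] using hy (X y.1) 0)
  have hAT := hA dT.differentiableAt (JS := JT) (by
    filter_upwards [hJ] with y hy
    simpa [JT, T] using hy 0 1)
  have b1 := fderiv_lieBracket_apply hF dJV.differentiableAt dJT.differentiableAt
  have b2 := fderiv_lieBracket_apply hF dJV.differentiableAt dT.differentiableAt
  have b3 := fderiv_lieBracket_apply hF dV.differentiableAt dJT.differentiableAt
  have b4 := fderiv_lieBracket_apply hF dV.differentiableAt dT.differentiableAt
  have e2 : VectorField.lieBracket ℝ JV T x = 0 := by
    rw [VectorField.lieBracket, dJV.fderiv, dT.fderiv]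
    simp [T]
  have e4 : VectorField.lieBracket ℝ V T x = 0 := by
    rw [VectorField.lieBracket, dV.fderiv, dT.fderiv]
    simp [T]
  have e3 : VectorField.lieBracket ℝ V JT x = (-VectorField.lieBracket ℝ ξ X x.1, 0) := by
    rw [VectorField.lieBracket, dV.fderiv, dJT.fderiv, VectorField.lieBracket]
    simp [V, JT]
  have e1 : (VectorField.lieBracket ℝ JV JT x).1 =
      -VectorField.lieBracket ℝ ξ (fun y => φ y (X y)) x.1 := by
    rw [VectorField.lieBracket, dJV.fderiv, dJT.fderiv, VectorField.lieBracket]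
    simp [JV, JT]
  -- Since A is constant it commutes with differentiation. Expanding both sides in derivatives of
  -- dF(V) and dF(T) leaves A² terms, which agree because [V, T] = 0 and [JV, T] = 0.
  have key : fderiv ℝ F x (VectorField.lieBracket ℝ JV JT x) =
      fderiv ℝ F x (φ x.1 (-VectorField.lieBracket ℝ ξ X x.1),
        α x.1 (-VectorField.lieBracket ℝ ξ X x.1)) := by
    have h1 := hJ.self_of_nhds (-VectorField.lieBracket ℝ ξ X x.1) 0
    rw [zero_smul, add_zero] at h1
    rw [h1, ← e3, b3, b1, hAT, hAV, hAT]
    rw [e4, map_zero] at b4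
    rw [e2, map_zero, hAV] at b2
    have h2 := congrArg A b4
    have h3 := congrArg A b2
    rw [map_zero, map_sub] at h2 h3
    rw [map_sub]
    have h4 : A (fderiv ℝ (fun y => fderiv ℝ F y (T y)) x (JV x)) =
        A (A (fderiv ℝ (fun y => fderiv ℝ F y (T y)) x (V x))) := by
      rw [sub_eq_zero.1 h3.symm, sub_eq_zero.1 b4.symm]
    rw [h4]
  have h5 := congrArg Prod.fst (hinj key)
  rw [e1, map_neg] at h5
  exact neg_injective h5

/-- In dimension three, `ker α` is spanned by `ξ` and `φ n`. -/
theorem exists_eq_of_mem_ker {V : Type*} [AddCommGroup V] [Module ℝ V]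
    (hV : finrank ℝ V = 3) {ξ : V} {φ : V →ₗ[ℝ] V} {α : V →ₗ[ℝ] ℝ} (hξ : ξ ≠ 0)
    (hφφ : ∀ v, φ (φ v) = -(α v • ξ)) (hφξ : φ ξ = 0) (hαφ : ∀ v, α (φ v) = 0) (hαξ : α ξ = 0)
    {n : V} (hn : α n ≠ 0) {v : V} (hv : α v = 0) : ∃ a b : ℝ, v = a • ξ + b • φ n := by
  -- Applying α to a relation kills the coefficient of n. Applying φ then kills that of φn, because
  -- φ²n is a nonzero multiple of ξ.
  have hli : LinearIndependent ℝ ![ξ, φ n, n] := by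
    rw [Fintype.linearIndependent_iff]
    intro c hc
    simp only [Fin.sum_univ_three, Matrix.cons_val_zero, Matrix.cons_val_one,
      Matrix.cons_val_two] at hc
    have h2 : c 2 = 0 := by
      have := congrArg α hc
      simpa [hαξ, hαφ, hn] using this
    rw [h2, zero_smul, add_zero] at hc
    have h1 : c 1 = 0 := by
      have := congrArg φ hc
      simpa [hφξ, hφφ, hn, hξ] using this
    rw [h1, zero_smul, add_zero] at hc
    have h0 : c 0 = 0 := (smul_eq_zero.1 hc).resolve_right hξ
    intro i
    fin_cases i <;> assumption
  have : FiniteDimensional ℝ V := Module.finite_of_finrank_eq_succ hV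
  have hspan := hli.span_eq_top_of_card_eq_finrank' (by simp [hV])
  obtain ⟨c, hc⟩ := (Submodule.mem_span_range_iff_exists_fun ℝ).1 
    (hspan ▸ Submodule.mem_top (x := v))
  simp only [Fin.sum_univ_three, Matrix.cons_val_zero, Matrix.cons_val_one,
    Matrix.cons_val_two] at hc
  have h2 : c 2 = 0 := by
    have := congrArg α hc
    simpa [hαξ, hαφ, hn, hv] using this
  rw [h2, zero_smul, add_zero] at hc
  exact ⟨_, _, hc.symm⟩

/-- A primitive along `ker α` of the one-form determined by `β(φ v) = -dℓ(v)`, when `φ` is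
invariant under `ξ`. -/
theorem exists_primitive_comp_charEndo {E : Type} [NormedAddCommGroup E] [NormedSpace ℝ E]
    (hE : finrank ℝ E = 3) {ξ : E → E} {φ : E → E →L[ℝ] E} {α : E → E →L[ℝ] ℝ} {y₀ n₀ : E}
    {l : E → ℝ}
    (hξ : ∀ᶠ y in 𝓝 y₀, ContDiffAt ℝ ∞ ξ y) (hφ : ∀ᶠ y in 𝓝 y₀, ContDiffAt ℝ ∞ φ y)
    (hα : ∀ᶠ y in 𝓝 y₀, ContDiffAt ℝ ∞ α y) (hl : ∀ᶠ y in 𝓝 y₀, ContDiffAt ℝ ∞ l y)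
    (hξ0 : ∀ᶠ y in 𝓝 y₀, ξ y ≠ 0) (hn : α y₀ n₀ = 1)
    (hφφ : ∀ᶠ y in 𝓝 y₀, ∀ v, φ y (φ y v) = -(α y v • ξ y)) (hφξ : ∀ᶠ y in 𝓝 y₀, φ y (ξ y) = 0)
    (hαφ : ∀ᶠ y in 𝓝 y₀, ∀ v, α y (φ y v) = 0) (hαξ : ∀ᶠ y in 𝓝 y₀, α y (ξ y) = 0)
    (hdα : ∀ᶠ y in 𝓝 y₀, ∀ u v, α y u = 0 → α y v = 0 → fderiv ℝ α y u v = fderiv ℝ α y v u)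
    (hlφ : ∀ᶠ y in 𝓝 y₀, ∀ v, fderiv ℝ l y (φ y v) = α y v)
    (hinv : ∀ᶠ y in 𝓝 y₀, VectorField.lieBracket ℝ ξ (fun y => φ y n₀) y =
      φ y (VectorField.lieBracket ℝ ξ (fun _ => n₀) y)) :
    ∃ f : E → ℝ, ∀ᶠ y in 𝓝 y₀, ContDiffAt ℝ ∞ f y ∧ fderiv ℝ f y (ξ y) = 1 ∧
      ∀ v, fderiv ℝ f y (φ y v) = -fderiv ℝ l y v := by
  have hfd : FiniteDimensional ℝ E := Module.finite_of_finrank_eq_succ hE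
  have : CompleteSpace E := FiniteDimensional.complete ℝ E
  obtain ⟨η, hη⟩ := SeparatingDual.exists_eq_one (R := ℝ) hξ0.self_of_nhds
  have hne : ∀ᶠ y in 𝓝 y₀, α y n₀ ≠ 0 := by
    have hc : ContinuousAt (fun y => α y n₀) y₀ :=
      hα.self_of_nhds.continuousAt.clm_apply continuousAt_const
    exact hc.eventually_ne (by rw [hn]; exact one_ne_zero)
  have hηξ : ∀ᶠ y in 𝓝 y₀, η (ξ y) ≠ 0 := by
    have hc : ContinuousAt (fun y => η (ξ y)) y₀ :=
      η.continuous.continuousAt.comp hξ.self_of_nhds.continuousAt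
    exact hc.eventually_ne (by rw [hη]; exact one_ne_zero)
  -- φ has kernel ℝξ and image ker α. Sending ξ to a nonzero multiple of n₀, which is transverse to
  -- ker α, completes it to an invertible map.
  let Ψ : E → E →L[ℝ] E := fun y => φ y + η.smulRight n₀
  have hΨv : ∀ y v, Ψ y v = φ y v + η v • n₀ := fun y v => rfl
  have hΨs : ∀ᶠ y in 𝓝 y₀, ContDiffAt ℝ ∞ Ψ y := by
    filter_upwards [hφ] with y hy using hy.add contDiffAt_const
  have hΨe : ∀ᶠ y in 𝓝 y₀, ∃ e : E ≃L[ℝ] E, (e : E →L[ℝ] E) = Ψ y := by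
    filter_upwards [hξ0, hφφ, hφξ, hαφ, hαξ, hne, hηξ]
      with y hξ0y hφφy hφξy hαφy hαξy hney hηξy
    have hinj : Function.Injective (Ψ y : E →ₗ[ℝ] E) := by
      rw [← LinearMap.ker_eq_bot, LinearMap.ker_eq_bot']
      intro v hv
      have hv' : φ y v + η v • n₀ = 0 := hv
      have hηv : η v = 0 := by
        have := congrArg (α y) hv'
        simpa [hαφy, hney] using this
      have hφv : φ y v = 0 := by simpa [hηv] using hv'
      have hαv : α y v = 0 := by
        have := hφφy v
        rw [hφv, map_zero] at this
        simpa [hξ0y] using this.symm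
      obtain ⟨a, b, rfl⟩ := exists_eq_of_mem_ker hE (φ := (φ y : E →ₗ[ℝ] E))
        (α := (α y : E →ₗ[ℝ] ℝ)) hξ0y hφφy hφξy hαφy hαξy hney hαv
      have hb : b = 0 := by
        simpa [hφξy, hφφy, hney, hξ0y] using hφv
      have ha : a = 0 := by
        simpa [hb, hηξy] using hηv
      simp [ha, hb]
    refine ⟨(LinearEquiv.ofInjectiveEndo _ hinj).toContinuousLinearEquiv, ?_⟩
    ext v
    rfl
  -- Inverting Ψ gives a smooth form on the whole space. Since Ψξ = η(ξ) n₀ and dl(ξ) = 0, it kills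
  -- n₀, so β ∘ φ = -dl.
  let β : E → E →L[ℝ] ℝ := fun y => -(fderiv ℝ l y ∘L (Ψ y).inverse)
  have hβs : ∀ᶠ y in 𝓝 y₀, ContDiffAt ℝ ∞ β y := by
    filter_upwards [hΨs, hΨe, hl] with y hy hy' hly
    obtain ⟨e, he⟩ := hy'
    have h1 : ContDiffAt ℝ ∞ ContinuousLinearMap.inverse (Ψ y) := he ▸ contDiffAt_map_inverse e
    exact ((hly.fderiv_right (by simp)).clm_comp (h1.comp y hy)).neg
  have hlξ : ∀ᶠ y in 𝓝 y₀, fderiv ℝ l y (ξ y) = 0 := by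
    filter_upwards [hφφ, hαφ, hlφ, hne] with y hφφy hαφy hlφy hney
    have h := hlφy (φ y n₀)
    rw [hφφy, hαφy, map_neg, map_smul, neg_eq_zero] at h
    exact (smul_eq_zero.1 h).resolve_left hney
  have hβφ : ∀ᶠ y in 𝓝 y₀, ∀ v, β y (φ y v) = -fderiv ℝ l y v := by
    filter_upwards [hΨe, hφξ, hηξ, hlξ] with y hy hφξy hηξy hlξy v
    obtain ⟨e, he⟩ := hy
    have hinv : ∀ w, (Ψ y).inverse (Ψ y w) = w := fun w => by
      rw [← he, ContinuousLinearMap.inverse_equiv]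
      exact e.symm_apply_apply w
    have hβΨ : ∀ w, β y (Ψ y w) = -fderiv ℝ l y w := fun w => by
      simp only [β, _root_.neg_apply, ContinuousLinearMap.comp_apply, hinv]
    have h1 : β y n₀ = 0 := by
      have := hβΨ (ξ y)
      rw [hΨv, hφξy, zero_add, map_smul, hlξy, neg_zero] at this
      exact (smul_eq_zero.1 this).resolve_left hηξy
    have h2 := hβΨ v
    rwa [hΨv, map_add, map_smul, h1, smul_zero, add_zero] at h2
  have hβξ : ∀ᶠ y in 𝓝 y₀, β y (ξ y) = 1 := by
    filter_upwards [hβφ, hφφ, hlφ, hne] with y hβφy hφφy hlφy hney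
    have h := hβφy (φ y n₀)
    rw [hφφy, hlφy, map_neg, map_smul, neg_inj, smul_eq_mul] at h
    exact mul_left_cancel₀ hney (by rw [h, mul_one])
  -- As β(ξ) = 1, only ξ(β(φn₀)) and β([ξ, φn₀]) contribute to dβ(ξ, φn₀). Invariance turns the
  -- latter into -dl([ξ, n₀]), and the two cancel on differentiating dl(ξ) = 0 along n₀.
  have hdβξ : ∀ᶠ y in 𝓝 y₀, fderiv ℝ β y (ξ y) (φ y n₀) = fderiv ℝ β y (φ y n₀) (ξ y) := by
    filter_upwards [hβs, hξ, hφ, hl, hβφ, hβφ.eventually_nhds, hβξ.eventually_nhds,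
      hlξ.eventually_nhds, hinv] with y hβy hξy hφy hly hβφy hβφy' hβξy' hlξy' hinvy
    have dβ : DifferentiableAt ℝ β y := hβy.differentiableAt (by simp)
    have dξ : DifferentiableAt ℝ ξ y := hξy.differentiableAt (by simp)
    have dφ : DifferentiableAt ℝ (fun y => φ y n₀) y :=
      (hφy.differentiableAt (by simp)).clm_apply (differentiableAt_const _)
    have dl : DifferentiableAt ℝ (fderiv ℝ l) y :=
      (hly.fderiv_right (m := ∞) (by simp)).differentiableAt (by simp)
    have h1 : fderiv ℝ (fun y => β y (φ y n₀)) y (ξ y) = -fderiv ℝ (fderiv ℝ l) y (ξ y) n₀ := by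
      have e : (fun y => β y (φ y n₀)) =ᶠ[𝓝 y] fun y => -fderiv ℝ l y n₀ :=
        hβφy'.mono fun x hx => hx n₀
      rw [e.fderiv_eq, fderiv_fun_neg, fderiv_clm_apply dl (differentiableAt_const _)]
      simp
    have h2 : fderiv ℝ (fun y => β y (ξ y)) y (φ y n₀) = 0 := by
      have e : (fun y => β y (ξ y)) =ᶠ[𝓝 y] fun _ => 1 := hβξy'
      rw [e.fderiv_eq]
      simp
    have h3 : fderiv ℝ (fun y => fderiv ℝ l y (ξ y)) y n₀ = 0 := by
      have e : (fun y => fderiv ℝ l y (ξ y)) =ᶠ[𝓝 y] fun _ => 0 := hlξy'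
      rw [e.fderiv_eq]
      simp
    rw [fderiv_clm_apply dβ dφ] at h1
    rw [fderiv_clm_apply dβ dξ] at h2
    rw [fderiv_clm_apply dl dξ] at h3
    simp only [_root_.add_apply, ContinuousLinearMap.comp_apply, ContinuousLinearMap.flip_apply]
      at h1 h2 h3
    have hs : IsSymmSndFDerivAt ℝ l y := hly.isSymmSndFDerivAt (by
      rw [minSmoothness_of_isRCLikeNormedField]
      exact WithTop.coe_le_coe.2 (le_top : (2 : ℕ∞) ≤ ⊤))
    have h4 := congrArg (β y) hinvy
    rw [hβφy] at h4
    simp only [VectorField.lieBracket, map_sub, fderiv_fun_const, Pi.zero_apply,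
      _root_.zero_apply, zero_sub, map_neg, neg_neg] at h4
    have h5 := hs.eq (ξ y) n₀
    linarith
  have hdβ : ∀ᶠ y in 𝓝 y₀, ∀ u v, α y u = 0 → α y v = 0 →
      fderiv ℝ β y u v = fderiv ℝ β y v u := by
    filter_upwards [hξ0, hφφ, hφξ, hαφ, hαξ, hne, hdβξ]
      with y hξ0y hφφy hφξy hαφy hαξy hney hdβy u v hu hv
    obtain ⟨a, b, rfl⟩ := exists_eq_of_mem_ker hE (φ := (φ y : E →ₗ[ℝ] E))
      (α := (α y : E →ₗ[ℝ] ℝ)) hξ0y hφφy hφξy hαφy hαξy hney hu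
    obtain ⟨c, d, rfl⟩ := exists_eq_of_mem_ker hE (φ := (φ y : E →ₗ[ℝ] E))
      (α := (α y : E →ₗ[ℝ] ℝ)) hξ0y hφφy hφξy hαφy hαξy hney hv
    simp only [map_add, map_smul, _root_.add_apply, _root_.smul_apply,
      ContinuousLinearMap.coe_coe, hdβy]
    simp only [smul_eq_mul]
    ring
  obtain ⟨_, _, f, hf⟩ := exists_integrating_factor_and_primitive hα hβs hn hdα hdβ
  refine ⟨f, ?_⟩
  filter_upwards [hf, hαξ, hαφ, hβξ, hβφ] with y hfy hαξy hαφy hβξy hβφy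
  obtain ⟨-, -, hfs, -, -, hfβ⟩ := hfy
  exact ⟨hfs, by rw [hfβ _ hαξy, hβξy], fun v => by rw [hfβ _ (hαφy v), hβφy]⟩

end Flat

/-! ### Coordinates in which J takes its nilpotent normal form. -/

section FlatCoordinates

/-- A nilpotent endomorphism of `E3 × ℝ`, the constant normal form of `J`. -/
noncomputable def nilpotentModel : (E3 × ℝ) →L[ℝ] (E3 × ℝ) :=
  ((ContinuousLinearMap.snd ℝ E3 ℝ).smulRight (EuclideanSpace.single (0 : Fin 3) (1 : ℝ)) +
    (EuclideanSpace.proj (2 : Fin 3) ∘L ContinuousLinearMap.fst ℝ E3 ℝ).smulRight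
      (EuclideanSpace.single (1 : Fin 3) (1 : ℝ))).prod 0

/-- If `φ` is invariant under `ξ`, then `J(v, c) = (φ v + c ξ, α v)` has constant coefficients in
suitable local coordinates of `E3 × ℝ`. -/
theorem exists_constant_coefficients {ξ : E3 → E3} {φ : E3 → E3 →L[ℝ] E3} {α : E3 → E3 →L[ℝ] ℝ}
    {y₀ : E3}
    (hξ : ∀ᶠ y in 𝓝 y₀, ContDiffAt ℝ ∞ ξ y) (hφ : ∀ᶠ y in 𝓝 y₀, ContDiffAt ℝ ∞ φ y)
    (hα : ∀ᶠ y in 𝓝 y₀, ContDiffAt ℝ ∞ α y) (hξ0 : ∀ᶠ y in 𝓝 y₀, ξ y ≠ 0) (hα0 : α y₀ ≠ 0)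
    (hφφ : ∀ᶠ y in 𝓝 y₀, ∀ v, φ y (φ y v) = -(α y v • ξ y)) (hφξ : ∀ᶠ y in 𝓝 y₀, φ y (ξ y) = 0)
    (hαφ : ∀ᶠ y in 𝓝 y₀, ∀ v, α y (φ y v) = 0) (hαξ : ∀ᶠ y in 𝓝 y₀, α y (ξ y) = 0)
    (hdα : ∀ᶠ y in 𝓝 y₀, ∀ v w,
      fderiv ℝ α y (φ y v) w - fderiv ℝ α y w (φ y v) = α y v * α y w)
    (hinv : ∀ n : E3, ∀ᶠ y in 𝓝 y₀, VectorField.lieBracket ℝ ξ (fun y => φ y n) y =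
      φ y (VectorField.lieBracket ℝ ξ (fun _ => n) y)) (q₀ : ℝ) :
    ∃ e : OpenPartialHomeomorph (E3 × ℝ) (E3 × ℝ), (y₀, q₀) ∈ e.source ∧ ∀ x ∈ e.source,
      ContDiffAt ℝ ∞ e x ∧ ContDiffAt ℝ ∞ e.symm (e x) ∧ ∀ (v : E3) (c : ℝ),
        fderiv ℝ e x (φ x.1 v + c • ξ x.1, α x.1 v) = nilpotentModel (fderiv ℝ e x (v, c)) := by
  have hE : finrank ℝ E3 = 3 := by simp
  obtain ⟨n₀, hn⟩ : ∃ n₀, α y₀ n₀ = 1 := by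
    obtain ⟨n, hn⟩ := DFunLike.ne_iff.1 hα0
    refine ⟨(α y₀ n)⁻¹ • n, ?_⟩
    rw [map_smul, smul_eq_mul]
    exact inv_mul_cancel₀ hn
  have hne : ∀ᶠ y in 𝓝 y₀, α y n₀ ≠ 0 := by
    have hc : ContinuousAt (fun y => α y n₀) y₀ :=
      hα.self_of_nhds.continuousAt.clm_apply continuousAt_const
    exact hc.eventually_ne (by rw [hn]; exact one_ne_zero)
  -- ker α is spanned by ξ and φn₀, and ξ = -φ(φn₀)/α(n₀) is itself in the image of φ.
  have hker : ∀ᶠ y in 𝓝 y₀, ∀ v, α y v = 0 → ∃ w, v = φ y w := by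
    filter_upwards [hξ0, hφφ, hφξ, hαφ, hαξ, hne] with y hξ0y hφφy hφξy hαφy hαξy hney v hv
    obtain ⟨a, b, rfl⟩ := exists_eq_of_mem_ker hE (φ := (φ y : E3 →ₗ[ℝ] E3))
      (α := (α y : E3 →ₗ[ℝ] ℝ)) hξ0y hφφy hφξy hαφy hαξy hney hv
    refine ⟨-(a * (α y n₀)⁻¹) • φ y n₀ + b • n₀, ?_⟩
    rw [map_add, map_smul, map_smul, hφφy, smul_neg, neg_smul, neg_neg, smul_smul,
      inv_mul_cancel_right₀ hney]
    rfl
  have hdα0 : ∀ᶠ y in 𝓝 y₀, ∀ u v, α y u = 0 → α y v = 0 →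
      fderiv ℝ α y u v = fderiv ℝ α y v u := by
    filter_upwards [hdα, hker] with y hdαy hkery u v hu hv
    obtain ⟨w, rfl⟩ := hkery u hu
    have h := hdαy w v
    rw [hv, mul_zero] at h
    exact sub_eq_zero.1 h
  obtain ⟨z, h, _, hzh⟩ := exists_integrating_factor_and_primitive hα
    (β := fun _ => 0) (Eventually.of_forall fun _ => contDiffAt_const) hn hdα0
    (Eventually.of_forall fun y u v _ _ => by simp)
  have hz : ∀ᶠ y in 𝓝 y₀, ContDiffAt ℝ ∞ z y := hzh.mono fun y hy => hy.1
  have hh : ∀ᶠ y in 𝓝 y₀, ContDiffAt ℝ ∞ h y := hzh.mono fun y hy => hy.2.1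
  have hpos : ∀ᶠ y in 𝓝 y₀, 0 < h y := hzh.mono fun y hy => hy.2.2.2.1
  have hαz : ∀ᶠ y in 𝓝 y₀, ∀ v, α y v = h y * fderiv ℝ z y v := hzh.mono fun y hy => hy.2.2.2.2.1
  -- Here dα = dh ∧ dz and dz(φv) = 0. Evaluating dα(φv, n₀) = α(v) α(n₀) and dividing by dz(n₀)
  -- gives the claim.
  have hdh : ∀ᶠ y in 𝓝 y₀, ∀ v, fderiv ℝ h y (φ y v) = h y * α y v := by
    filter_upwards [hα, hz, hh, hpos, hαz, hαz.eventually_nhds, hdα, hαφ, hne]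
      with y hαy hzy hhy hposy hαzy hαzy' hdαy hαφy hney v
    have dz : DifferentiableAt ℝ (fderiv ℝ z) y :=
      (hzy.fderiv_right (m := ∞) (by simp)).differentiableAt (by simp)
    have h1 : fderiv ℝ α y = fderiv ℝ (fun y => h y • fderiv ℝ z y) y := by
      refine Filter.EventuallyEq.fderiv_eq (hαzy'.mono fun x hx => ?_)
      ext v
      exact hx v
    rw [fderiv_fun_smul (hhy.differentiableAt (by simp)) dz] at h1
    have hs : IsSymmSndFDerivAt ℝ z y := hzy.isSymmSndFDerivAt (by
      rw [minSmoothness_of_isRCLikeNormedField]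
      exact WithTop.coe_le_coe.2 (le_top : (2 : ℕ∞) ≤ ⊤))
    have h2 := hdαy v n₀
    have h3 : fderiv ℝ z y (φ y v) = 0 := by
      have := hαφy v
      rw [hαzy] at this
      exact (mul_eq_zero.1 this).resolve_left hposy.ne'
    rw [h1] at h2
    simp only [_root_.add_apply, _root_.smul_apply, ContinuousLinearMap.smulRight_apply,
      smul_eq_mul, h3, mul_zero, add_zero, hs.eq (φ y v) n₀] at h2
    have h4 := hαzy n₀
    have h5 : fderiv ℝ z y n₀ ≠ 0 := fun h0 => hney (by rw [h4, h0, mul_zero])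
    refine mul_right_cancel₀ h5 ?_
    rw [h4] at h2
    linarith
  let l : E3 → ℝ := fun y => Real.log (h y)
  have hl : ∀ᶠ y in 𝓝 y₀, ContDiffAt ℝ ∞ l y := by
    filter_upwards [hh, hpos] with y hy hy' using hy.log hy'.ne'
  have hdl : ∀ᶠ y in 𝓝 y₀, fderiv ℝ l y = (h y)⁻¹ • fderiv ℝ h y := by
    filter_upwards [hh, hpos] with y hy hy'
    exact (hy.differentiableAt (by simp)).hasFDerivAt.log hy'.ne' |>.fderiv
  have hlφ : ∀ᶠ y in 𝓝 y₀, ∀ v, fderiv ℝ l y (φ y v) = α y v := by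
    filter_upwards [hdl, hdh, hpos] with y hy hy' hy'' v
    rw [hy, _root_.smul_apply, hy', smul_eq_mul, inv_mul_cancel_left₀ hy''.ne']
  have hhξ : ∀ᶠ y in 𝓝 y₀, fderiv ℝ h y (ξ y) = 0 := by
    filter_upwards [hφφ, hαφ, hdh, hne] with y hφφy hαφy hdhy hney
    have h := hdhy (φ y n₀)
    rw [hφφy, hαφy, map_neg, map_smul, mul_zero, neg_eq_zero] at h
    exact (smul_eq_zero.1 h).resolve_left hney
  obtain ⟨f, hf⟩ := exists_primitive_comp_charEndo hE hξ hφ hα hl hξ0 hn hφφ hφξ hαφ hαξ hdα0 hlφ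
    (hinv n₀)
  let b : Fin 3 → E3 := fun i => EuclideanSpace.single i (1 : ℝ)
  -- The choice -1/h makes the second coordinate pull back to dz under J: d(-1/h)(φv) = h⁻² · hα(v)
  -- = dz(v). In `F`, subtracting l from q cancels α in the last component.
  let F₁ : E3 → E3 := fun y => f y • b 0 + -(h y)⁻¹ • b 1 + z y • b 2
  let F : E3 × ℝ → E3 × ℝ := fun x => (F₁ x.1, x.2 - l x.1)
  have hF₁ : ∀ᶠ y in 𝓝 y₀, ContDiffAt ℝ ∞ F₁ y := by
    filter_upwards [hf, hh, hpos, hz] with y hfy hhy hposy hzy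
    exact ((hfy.1.smul contDiffAt_const).add ((hhy.inv hposy.ne').neg.smul contDiffAt_const)).add
      (hzy.smul contDiffAt_const)
  have hdF₁ : ∀ᶠ y in 𝓝 y₀, ∀ v, fderiv ℝ F₁ y v = fderiv ℝ f y v • b 0 +
      ((h y ^ 2)⁻¹ * fderiv ℝ h y v) • b 1 + fderiv ℝ z y v • b 2 := by
    filter_upwards [hf, hh, hpos, hz] with y hfy hhy hposy hzy v
    have h1 := (hfy.1.differentiableAt (by simp)).hasFDerivAt.smul_const (b 0)
    have h2 := ((hasDerivAt_inv hposy.ne').comp_hasFDerivAt y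
      (hhy.differentiableAt (by simp)).hasFDerivAt).neg.smul_const (b 1)
    have h3 := (hzy.differentiableAt (by simp)).hasFDerivAt.smul_const (b 2)
    have h4 : fderiv ℝ F₁ y = _ := ((h1.add h2).add h3).fderiv
    rw [h4]
    simp
  have htend : Tendsto (Prod.fst : E3 × ℝ → E3) (𝓝 (y₀, q₀)) (𝓝 y₀) :=
    continuous_fst.tendsto (y₀, q₀)
  have hFs : ∀ᶠ x in 𝓝 (y₀, q₀), ContDiffAt ℝ ∞ F x := by
    filter_upwards [htend.eventually hF₁, htend.eventually hl] with x hx hx'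
    exact (hx.comp x contDiffAt_fst).prodMk (contDiffAt_snd.sub (hx'.comp x contDiffAt_fst))
  have hdF : ∀ᶠ x in 𝓝 (y₀, q₀), ∀ (v : E3) (c : ℝ),
      fderiv ℝ F x (v, c) = (fderiv ℝ f x.1 v • b 0 + ((h x.1 ^ 2)⁻¹ * fderiv ℝ h x.1 v) • b 1 +
        fderiv ℝ z x.1 v • b 2, c - (h x.1)⁻¹ * fderiv ℝ h x.1 v) := by
    filter_upwards [htend.eventually hF₁, htend.eventually hl, htend.eventually hdF₁,
      htend.eventually hdl] with x hx hx' hdx hdlx v c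
    have h1 := ((hx.differentiableAt (by simp)).hasFDerivAt.comp x hasFDerivAt_fst).prodMk
      (hasFDerivAt_snd.sub ((hx'.differentiableAt (by simp)).hasFDerivAt.comp x hasFDerivAt_fst))
    have h2 : fderiv ℝ F x = _ := h1.fderiv
    rw [h2]
    change (fderiv ℝ F₁ x.1 v, c - fderiv ℝ l x.1 v) = _
    rw [hdx, hdlx]
    rfl
  have hcomm : ∀ᶠ x in 𝓝 (y₀, q₀), ∀ (v : E3) (c : ℝ),
      fderiv ℝ F x (φ x.1 v + c • ξ x.1, α x.1 v) = nilpotentModel (fderiv ℝ F x (v, c)) := by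
    filter_upwards [hdF, htend.eventually hf, htend.eventually hdl, htend.eventually hdh,
      htend.eventually hhξ, htend.eventually hpos, htend.eventually hαz, htend.eventually hαφ,
      htend.eventually hαξ] with x hdFx hfx hdlx hdhx hhξx hposx hαzx hαφx hαξx v c
    have hz0 : ∀ v, α x.1 v = 0 → fderiv ℝ z x.1 v = 0 := fun v hv => by
      rw [hαzx] at hv
      exact (mul_eq_zero.1 hv).resolve_left hposx.ne'
    rw [hdFx, hdFx]
    simp only [map_add, map_smul, hfx.2.1, hfx.2.2, hdlx, hdhx, hhξx, hz0 _ (hαφx v), hz0 _ hαξx,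
      _root_.smul_apply, smul_eq_mul, mul_zero, add_zero, mul_one]
    refine Prod.ext ?_ ?_
    · have e1 : (h x.1 ^ 2)⁻¹ * (h x.1 * α x.1 v) = fderiv ℝ z x.1 v := by
        rw [hαzx]
        field_simp
      rw [e1]
      ext i
      fin_cases i <;> simp [nilpotentModel, b]
      ring
    · simp only [nilpotentModel, ContinuousLinearMap.prod_apply, _root_.zero_apply]
      rw [inv_mul_cancel_left₀ hposx.ne', sub_self]
  -- If dz(v) = 0 then v = φw. If also dh(v) = 0 then α(w) = 0, so w = φu and v = -α(u) ξ. Finally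
  -- df(v) = 0 gives α(u) = 0, and the last component gives c = 0.
  have hinj : Function.Injective (fderiv ℝ F (y₀, q₀) : E3 × ℝ →ₗ[ℝ] E3 × ℝ) := by
    rw [← LinearMap.ker_eq_bot, LinearMap.ker_eq_bot']
    rintro ⟨v, c⟩ hv
    have hv' : fderiv ℝ F (y₀, q₀) (v, c) = 0 := hv
    rw [hdF.self_of_nhds] at hv'
    have h1 := congrArg Prod.fst hv'
    have h2 := congrArg Prod.snd hv'
    have hf0 : fderiv ℝ f y₀ v = 0 := by
      simpa [b] using congrArg (fun w : E3 => w 0) h1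
    have hz0 : fderiv ℝ z y₀ v = 0 := by
      simpa [b] using congrArg (fun w : E3 => w 2) h1
    have hh0 : fderiv ℝ h y₀ v = 0 := by
      simpa [b, hpos.self_of_nhds.ne'] using congrArg (fun w : E3 => w 1) h1
    have hα0 : α y₀ v = 0 := by rw [hαz.self_of_nhds, hz0, mul_zero]
    obtain ⟨w, rfl⟩ := hker.self_of_nhds v hα0
    have hw : α y₀ w = 0 := by
      rw [hdh.self_of_nhds] at hh0
      exact (mul_eq_zero.1 hh0).resolve_left hpos.self_of_nhds.ne'
    obtain ⟨u, rfl⟩ := hker.self_of_nhds w hw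
    have hu : α y₀ u = 0 := by
      rw [hφφ.self_of_nhds, map_neg, map_smul, hf.self_of_nhds.2.1] at hf0
      simpa using hf0
    have hc : c = 0 := by
      simp only [hh0, mul_zero, sub_zero] at h2
      exact h2
    rw [hφφ.self_of_nhds, hu, zero_smul, neg_zero, hc]
    rfl
  let F' : (E3 × ℝ) ≃L[ℝ] (E3 × ℝ) := (LinearEquiv.ofInjectiveEndo _ hinj).toContinuousLinearEquiv
  have hF' : HasFDerivAt F (F' : E3 × ℝ →L[ℝ] E3 × ℝ) (y₀, q₀) := by
    refine (hFs.self_of_nhds.differentiableAt (by simp)).hasFDerivAt.congr_fderiv ?_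
    ext v <;> rfl
  obtain ⟨e, he, hye, hes⟩ := exists_openPartialHomeomorph_of_contDiffAt hFs hF'
  obtain ⟨s, hs, hso, hys⟩ := eventually_nhds_iff.1 hcomm
  refine ⟨e.restrOpen s hso, ⟨hye, hys⟩, fun x hx => ?_⟩
  have hcoe : ⇑(e.restrOpen s hso) = F := he
  rw [hcoe]
  exact ⟨(hes x hx.1).1, (hes x hx.1).2, hs x hx.2⟩

end FlatCoordinates

/-! ### The characteristic endomorphism of a null covector -/

section LorentzAlgebra

variable {V : Type*} [AddCommGroup V] [Module ℝ V]
  {B : LinearMap.BilinForm ℝ V}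

theorem apply_lorentzSharp [FiniteDimensional ℝ V] (hB : IsLorentzianForm B) (β : Dual ℝ V) (v : V) :
    B (lorentzSharp hB β) v = β v :=
  LinearMap.BilinForm.apply_toDual_symm_apply β v

theorem hodgeStarOne_apply [FiniteDimensional ℝ V] (hB : IsLorentzianForm B) (o : Orientation ℝ V (Fin 3)) (β : Dual ℝ V)
    (v w : V) : hodgeStarOne hB o β v w = lorentzVolume hB o ![lorentzSharp hB β, v, w] := rfl

/-- The determinant of three vectors in terms of their coordinates. -/
theorem basis_det_vec_three (b : Basis (Fin 3) ℝ V) (x v w : V) :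
    b.det ![x, v, w] =
      b.repr x 0 * (b.repr v 1 * b.repr w 2 - b.repr v 2 * b.repr w 1) -
      b.repr x 1 * (b.repr v 0 * b.repr w 2 - b.repr v 2 * b.repr w 0) +
      b.repr x 2 * (b.repr v 0 * b.repr w 1 - b.repr v 1 * b.repr w 0) := by
  rw [Basis.det_apply, Matrix.det_fin_three]
  simp [Basis.toMatrix_apply]
  ring

/-- This is the change-of-basis formula for Gram determinants, with det diag(-1, 1, 1) = -1. It
fixes the sign of every Gram determinant and normalises the volume form in a Lorentz basis. -/
theorem gram_det_mul_sq (b c : Basis (Fin 3) ℝ V)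
    (hb : ∀ i j, B (b i) (b j) = if i = j then (if i = 0 then -1 else 1) else 0) :
    (c.det b) ^ 2 * (Matrix.of fun i j => B (c i) (c j)).det = -1 := by
  have h1 := congrArg Matrix.det (LinearMap.BilinForm.toMatrix_mul_basis_toMatrix c b B)
  have h2 : LinearMap.BilinForm.toMatrix c B = Matrix.of fun i j => B (c i) (c j) := by
    ext i j
    simp [LinearMap.BilinForm.toMatrix_apply]
  have h3 : (LinearMap.BilinForm.toMatrix b B).det = -1 := by
    simp [Matrix.det_fin_three, LinearMap.BilinForm.toMatrix_apply, hb]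
  rw [h3, Matrix.det_mul, Matrix.det_mul, Matrix.det_transpose, h2, ← Basis.det_apply] at h1
  linarith

/-- In a Lorentz basis the volume form is the determinant up to sign. -/
theorem exists_lorentzVolume_eq [FiniteDimensional ℝ V] (hB : IsLorentzianForm B)
    (o : Orientation ℝ V (Fin 3)) :
    ∃ (b : Basis (Fin 3) ℝ V) (σ : ℝ), σ * σ = 1 ∧
      (∀ i j, B (b i) (b j) = if i = j then (if i = 0 then -1 else 1) else 0) ∧
      ∀ x v w, lorentzVolume hB o ![x, v, w] = σ * b.det ![x, v, w] := by
  obtain ⟨b, hb⟩ := id hB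
  refine ⟨b, lorentzVolume hB o b, ?_, hb, fun x v w => ?_⟩
  · have h := gram_det_mul_sq b (o.someBasis hB.card_eq) hb
    set c := o.someBasis hB.card_eq
    set d := (Matrix.of fun i j => B (c i) (c j)).det
    have hν : lorentzVolume hB o b = √|d| * c.det b := rfl
    have hd : d < 0 := by nlinarith [sq_nonneg (c.det b)]
    rw [hν, mul_mul_mul_comm, Real.mul_self_sqrt (abs_nonneg d), abs_of_neg hd]
    linarith
  · conv_lhs => rw [AlternatingMap.eq_smul_basis_det b (lorentzVolume hB o)]
    rfl

/-- `β ↦ ∗β` on two-forms is inverted by `-∗`. -/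
theorem eq_neg_hodgeStarOne_of_eq_hodgeStarTwo [FiniteDimensional ℝ V] (hB : IsLorentzianForm B)
    (o : Orientation ℝ V (Fin 3)) {β : V →ₗ[ℝ] V →ₗ[ℝ] ℝ} (hβ : ∀ v w, β v w = -β w v)
    {α : Dual ℝ V} (h : ∀ v, α v = hodgeStarTwo hB o (fun v w => β v w) v) :
    β = -hodgeStarOne hB o α := by
  obtain ⟨e, he⟩ := id hB
  -- The computation runs in the basis used to define the volume form and the Hodge star. The
  -- Lorentz basis e only supplies the sign of the Gram determinant and the symmetry of B.
  set b := o.someBasis hB.card_eq with hb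
  set G := Matrix.of fun i j => B (b i) (b j) with hG
  have hdet := gram_det_mul_sq e b he
  have hGneg : G.det < 0 := by nlinarith [sq_nonneg (b.det e)]
  set s := √|G.det| with hs
  have hν : ∀ x v w, lorentzVolume hB o ![x, v, w] = s * b.det ![x, v, w] := fun _ _ _ => rfl
  let c : Fin 3 → V := fun i => lorentzSharp hB (b.coord i)
  have hc : ∀ i v, B (c i) v = b.repr v i := fun i v => apply_lorentzSharp hB _ v
  have hBs : ∀ v w, B v w = B w v := by
    intro v w
    have : B = B.flip := by
      refine LinearMap.ext_basis e e fun i j => ?_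
      rw [show B.flip (e i) (e j) = B (e j) (e i) from rfl, he, he]
      by_cases hij : i = j
      · rw [hij]
      · rw [if_neg hij, if_neg (Ne.symm hij)]
    conv_lhs => rw [this]
    rfl
  -- The coordinates of the metric dual basis c form the inverse of the Gram matrix.
  have hcdet : b.det c * G.det = 1 := by
    rw [Basis.det_apply, mul_comm, ← Matrix.det_mul, ← Matrix.det_one (n := Fin 3)]
    congr 1
    ext k i
    have h1 : B (b k) (∑ j, b.repr (c i) j • b j) = b.repr (b k) i := by
      rw [b.sum_repr, hBs, hc]
    rw [Matrix.mul_apply]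
    simp only [map_sum, map_smul, smul_eq_mul] at h1
    simp only [hG, Matrix.of_apply, Basis.toMatrix_apply]
    have h2 : b.repr (b k) i = if k = i then 1 else 0 := by
      rw [b.repr_self, Finsupp.single_apply]
    rw [Matrix.one_apply, ← h2, ← h1]
    exact Finset.sum_congr rfl fun j _ => mul_comm _ _
  -- Since s² = |det G| = -det G, the Lorentzian sign appears here; it is the sign in ∗∗ = -1.
  have hsδ : s * (s * b.det c) = -1 := by
    rw [← mul_assoc, Real.mul_self_sqrt (abs_nonneg _), abs_of_neg hGneg]
    linarith
  set δ := b.det c with hδ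
  have hδ' : ∀ i j k, b.det ![c i, c j, c k] = δ * b.det ![b i, b j, b k] := by
    intro i j k
    let C : V →ₗ[ℝ] V := b.constr ℝ c
    have hC : ∀ i, C (b i) = c i := b.constr_basis ℝ c
    have h1 := congrArg (fun T : AlternatingMap ℝ V ℝ (Fin 3) => T ![b i, b j, b k])
      (AlternatingMap.eq_smul_basis_det (R := ℝ) (M := V) b (b.det.compLinearMap C))
    have h2 : (fun l => C (![b i, b j, b k] l)) = ![c i, c j, c k] := by
      funext l
      fin_cases l <;> simp [hC]
    have h3 : (fun l => C (b l)) = c := funext hC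
    simp only [AlternatingMap.smul_apply, AlternatingMap.compLinearMap_apply, smul_eq_mul] at h1
    rw [← h2, hδ, ← h3]
    exact h1
  have hβ0 : ∀ v, β v v = 0 := fun v => by linarith [hβ v v]
  have hα : ∀ v, α v = (1 / 2 : ℝ) * ∑ i, ∑ j, β (b i) (b j) * (s * b.det ![c i, c j, v]) := h
  have hξ : ∀ i, b.repr (lorentzSharp hB α) i = α (c i) := fun i => by
    rw [← hc, hBs, apply_lorentzSharp]
  have h01 := hβ (b 1) (b 0)
  have h02 := hβ (b 2) (b 0)
  have h12 := hβ (b 2) (b 1)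
  have hα0 : α (c 0) = s * δ * β (b 1) (b 2) := by
    simp [hα, hδ', Fin.sum_univ_three, basis_det_vec_three, hβ0, h12]
    ring
  have hα1 : α (c 1) = -(s * δ * β (b 0) (b 2)) := by
    simp [hα, hδ', Fin.sum_univ_three, basis_det_vec_three, hβ0, h01, h02]
    ring
  have hα2 : α (c 2) = s * δ * β (b 0) (b 1) := by
    simp [hα, hδ', Fin.sum_univ_three, basis_det_vec_three, hβ0, h01, h02, h12]
    ring
  refine LinearMap.ext_basis b b fun i j => ?_
  rw [LinearMap.neg_apply, LinearMap.neg_apply, hodgeStarOne_apply, hν, basis_det_vec_three]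
  simp only [hξ, hα0, hα1, hα2]
  fin_cases i <;> fin_cases j <;> simp [hβ0, h01, h02, h12]
  · linear_combination β (b 0) (b 1) * hsδ
  · linear_combination β (b 0) (b 2) * hsδ
  · linear_combination -β (b 0) (b 1) * hsδ
  · linear_combination β (b 1) (b 2) * hsδ
  · linear_combination -β (b 0) (b 2) * hsδ
  · linear_combination -β (b 1) (b 2) * hsδ

/-- In a Lorentz basis φ is, up to sign, the cross product with ξ followed by raising an index. The
formula for φ² is then the double cross product identity, in which B(ξ, ξ) = 0 removes the term
proportional to v. -/
theorem charEndo_algebra [FiniteDimensional ℝ V] (hB : IsLorentzianForm B) (o : Orientation ℝ V (Fin 3)) {α : Dual ℝ V}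
    (hα : B (lorentzSharp hB α) (lorentzSharp hB α) = 0) :
    (∀ v, lorentzSharp hB (hodgeStarOne hB o α (lorentzSharp hB (hodgeStarOne hB o α v))) =
      -(α v • lorentzSharp hB α)) ∧
    lorentzSharp hB (hodgeStarOne hB o α (lorentzSharp hB α)) = 0 ∧
    (∀ v, α (lorentzSharp hB (hodgeStarOne hB o α v)) = 0) ∧ α (lorentzSharp hB α) = 0 := by
  obtain ⟨b, σ, hσ, hb, hν⟩ := exists_lorentzVolume_eq hB o
  have hBc : ∀ u w, B u w =
      -(b.repr u 0 * b.repr w 0) + b.repr u 1 * b.repr w 1 + b.repr u 2 * b.repr w 2 := by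
    intro u w
    conv_lhs => rw [← b.sum_repr u, ← b.sum_repr w]
    simp only [Fin.sum_univ_three, map_add, map_smul, LinearMap.add_apply, LinearMap.smul_apply, hb]
    simp
    ring
  have hrepr0 : ∀ β : Dual ℝ V, b.repr (lorentzSharp hB β) 0 = -β (b 0) := fun β => by
    have := apply_lorentzSharp hB β (b 0)
    rw [hBc] at this
    simp at this
    linarith
  have hrepr1 : ∀ β : Dual ℝ V, b.repr (lorentzSharp hB β) 1 = β (b 1) := fun β => by
    have := apply_lorentzSharp hB β (b 1)
    rw [hBc] at this
    simpa using this
  have hrepr2 : ∀ β : Dual ℝ V, b.repr (lorentzSharp hB β) 2 = β (b 2) := fun β => by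
    have := apply_lorentzSharp hB β (b 2)
    rw [hBc] at this
    simpa using this
  set ξ := lorentzSharp hB α with hξ
  have hα' : ∀ v, α v = B ξ v := fun v => (apply_lorentzSharp hB α v).symm
  have h1 : ∀ v w, hodgeStarOne hB o α v w = σ * b.det ![ξ, v, w] := fun v w => by
    rw [hodgeStarOne_apply, hν]
  rw [hBc] at hα
  refine ⟨fun v => b.repr.injective (Finsupp.ext fun i => ?_),
    b.repr.injective (Finsupp.ext fun i => ?_), fun v => ?_, ?_⟩
  · fin_cases i <;>
      simp [hrepr0, hrepr1, hrepr2, h1, hα', hBc, basis_det_vec_three]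
    · linear_combination ((-(b.repr ξ 0 * b.repr v 0) + b.repr ξ 1 * b.repr v 1 +
        b.repr ξ 2 * b.repr v 2) * b.repr ξ 0) * hσ - σ * σ * b.repr v 0 * hα
    · linear_combination (-(-(b.repr ξ 0 * b.repr v 0) + b.repr ξ 1 * b.repr v 1 +
        b.repr ξ 2 * b.repr v 2) * b.repr ξ 1) * hσ + σ * σ * b.repr v 1 * hα
    · linear_combination (-(-(b.repr ξ 0 * b.repr v 0) + b.repr ξ 1 * b.repr v 1 +
        b.repr ξ 2 * b.repr v 2) * b.repr ξ 2) * hσ + σ * σ * b.repr v 2 * hα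
  · fin_cases i <;> simp [hrepr0, hrepr1, hrepr2, h1, basis_det_vec_three]
    all_goals exact Or.inr (by ring)
  · rw [hα', hBc]
    simp [hrepr0, hrepr1, hrepr2, h1, basis_det_vec_three]
    ring
  · rw [hα', hBc, hα]

end LorentzAlgebra

/-! ### Components in a chart -/

section Charts

variable {M : Type*} [TopologicalSpace M] [ChartedSpace E3 M] [IsManifold (𝓡 3) ∞ M]

/-- The vector with components `v` in the chart at `p`. -/
noncomputable def chartFrame (p : M) (y : E3) :
    E3 →L[ℝ] TangentSpace (𝓡 3) ((extChartAt (𝓡 3) p).symm y) :=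
  mfderiv 𝓘(ℝ, E3) (𝓡 3) (extChartAt (𝓡 3) p).symm y

/-- The components of a tangent vector in the chart at `p`. -/
noncomputable def chartCoord (p x : M) : TangentSpace (𝓡 3) x →L[ℝ] E3 :=
  mfderiv (𝓡 3) 𝓘(ℝ, E3) (extChartAt (𝓡 3) p) x

theorem chartCoord_chartFrame {p : M} {y : E3} (hy : y ∈ (extChartAt (𝓡 3) p).target) (v : E3) :
    chartCoord p ((extChartAt (𝓡 3) p).symm y) (chartFrame p y v) = v := by
  have h := mfderiv_extChartAt_comp_mfderivWithin_extChartAt_symm hy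
  rw [ModelWithCorners.range_eq_univ, mfderivWithin_univ] at h
  exact congrArg (fun T : E3 →L[ℝ] E3 => T v) h

theorem chartFrame_chartCoord {p : M} {y : E3} (hy : y ∈ (extChartAt (𝓡 3) p).target)
    (v : TangentSpace (𝓡 3) ((extChartAt (𝓡 3) p).symm y)) :
    chartFrame p y (chartCoord p ((extChartAt (𝓡 3) p).symm y) v) = v := by
  have h := mfderivWithin_extChartAt_symm_comp_mfderiv_extChartAt hy
  rw [ModelWithCorners.range_eq_univ, mfderivWithin_univ] at h
  exact congrArg (fun T : E3 →L[ℝ] E3 => T v) h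

theorem inverse_chartCoord {p : M} {y : E3} (hy : y ∈ (extChartAt (𝓡 3) p).target) :
    (chartCoord p ((extChartAt (𝓡 3) p).symm y)).inverse = chartFrame p y :=
  ContinuousLinearMap.inverse_eq
    (ContinuousLinearMap.ext (chartCoord_chartFrame hy))
    (ContinuousLinearMap.ext (chartFrame_chartCoord hy))

theorem inverse_chartFrame {p : M} {y : E3} (hy : y ∈ (extChartAt (𝓡 3) p).target) :
    (chartFrame p y).inverse = chartCoord p ((extChartAt (𝓡 3) p).symm y) :=
  ContinuousLinearMap.inverse_eq
    (ContinuousLinearMap.ext (chartFrame_chartCoord hy))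
    (ContinuousLinearMap.ext (chartCoord_chartFrame hy))

omit [IsManifold (𝓡 3) ∞ M] in
theorem extChartAt_target_mem_nhds_of_mem {p : M} {y : E3}
    (hy : y ∈ (extChartAt (𝓡 3) p).target) : (extChartAt (𝓡 3) p).target ∈ 𝓝 y :=
  (isOpen_extChartAt_target p).mem_nhds hy

theorem contMDiffAt_extChartAt_symm {p : M} {y : E3} (hy : y ∈ (extChartAt (𝓡 3) p).target) :
    ContMDiffAt 𝓘(ℝ, E3) (𝓡 3) ∞ (extChartAt (𝓡 3) p).symm y :=
  (contMDiffOn_extChartAt_symm p).contMDiffAt (extChartAt_target_mem_nhds_of_mem hy)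

theorem contMDiffAt_extChartAt_of_target {p : M} {y : E3}
    (hy : y ∈ (extChartAt (𝓡 3) p).target) :
    ContMDiffAt (𝓡 3) 𝓘(ℝ, E3) ∞ (extChartAt (𝓡 3) p) ((extChartAt (𝓡 3) p).symm y) :=
  contMDiffAt_extChartAt' (by
    have h := (extChartAt (𝓡 3) p).map_target hy
    rwa [extChartAt_source] at h)

theorem mpullback_extChartAt_apply {p : M} {y : E3}
    (hy : y ∈ (extChartAt (𝓡 3) p).target) (X : E3 → E3) :
    VectorField.mpullback (𝓡 3) 𝓘(ℝ, E3) (extChartAt (𝓡 3) p) X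
      ((extChartAt (𝓡 3) p).symm y) = chartFrame p y (X y) := by
  have h : X (extChartAt (𝓡 3) p ((extChartAt (𝓡 3) p).symm y)) = X y := by
    rw [(extChartAt (𝓡 3) p).right_inv hy]
  exact congrArg₂ (fun (T : E3 →L[ℝ] E3) v => T v) (inverse_chartCoord hy) h

/-- A vector field with smooth components is smooth. -/
theorem contMDiffAt_mpullback_extChartAt {p : M} {y : E3}
    (hy : y ∈ (extChartAt (𝓡 3) p).target) {X : E3 → E3} (hX : ContDiffAt ℝ ∞ X y) :
    ContMDiffAt (𝓡 3) (𝓡 3).tangent ∞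
      (fun x => (⟨x, VectorField.mpullback (𝓡 3) 𝓘(ℝ, E3) (extChartAt (𝓡 3) p) X x⟩ :
        TangentBundle (𝓡 3) M)) ((extChartAt (𝓡 3) p).symm y) := by
  have : IsManifold (𝓡 3) 1 M := IsManifold.of_le (n := ∞) (by simp)
  refine ContMDiffAt.mpullback_vectorField_preimage (n := ∞) ?_
    (contMDiffAt_extChartAt_of_target hy)
    (isInvertible_mfderiv_extChartAt ((extChartAt (𝓡 3) p).map_target hy)) (by simp)
  rw [(extChartAt (𝓡 3) p).right_inv hy]
  exact contMDiffAt_vectorSpace_iff_contDiffAt.2 hX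

theorem contMDiffAt_chartFrame {p : M} {y : E3}
    (hy : y ∈ (extChartAt (𝓡 3) p).target) (v : E3) :
    ContMDiffAt 𝓘(ℝ, E3) (𝓡 3).tangent ∞
      (fun y => (⟨(extChartAt (𝓡 3) p).symm y, chartFrame p y v⟩ : TangentBundle (𝓡 3) M)) y := by
  have h := (contMDiffAt_mpullback_extChartAt hy (contDiffAt_const (c := v))).comp y
    (contMDiffAt_extChartAt_symm hy)
  refine h.congr_of_eventuallyEq ?_
  filter_upwards [extChartAt_target_mem_nhds_of_mem hy] with z hz
  simp only [Function.comp_apply]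
  congr 1
  exact (mpullback_extChartAt_apply hz fun _ => v).symm

/-- In finite dimension a family of covectors is smooth once its values on constant vectors are, and
the coordinate frame is a smooth family of tangent vectors. -/
theorem contDiffAt_inChart (α : OneForm M) {p : M} {y : E3}
    (hy : y ∈ (extChartAt (𝓡 3) p).target) : ContDiffAt ℝ ∞ (α.inChart p) y := by
  refine ContDiffOn.contDiffAt ?_ (extChartAt_target_mem_nhds_of_mem hy)
  refine contDiffOn_clm_apply.2 fun v z hz => ContDiffAt.contDiffWithinAt ?_
  have h : ContMDiffAt 𝓘(ℝ, E3) ((𝓡 3).prod 𝓘(ℝ)) ∞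
      (fun m ↦ TotalSpace.mk' ℝ (E := Bundle.Trivial M ℝ) ((extChartAt (𝓡 3) p).symm m)
        (α ((extChartAt (𝓡 3) p).symm m) (chartFrame p m v))) z := by
    apply ContMDiffAt.clm_bundle_apply (F₁ := E3)
    · exact α.contMDiff.contMDiffAt.comp z (contMDiffAt_extChartAt_symm hz)
    · exact contMDiffAt_chartFrame hz v
  simp only [contMDiffAt_totalSpace] at h
  exact h.2.contDiffAt

/-- The components of a metric in the chart at `p`. -/
noncomputable def LorentzianMetric.inChart (g : LorentzianMetric M) (p : M) (y : E3) :
    E3 →L[ℝ] E3 →L[ℝ] ℝ :=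
  let G : E3 →L[ℝ] E3 →L[ℝ] ℝ := g.inner ((extChartAt (𝓡 3) p).symm y)
  let D : E3 →L[ℝ] E3 := chartFrame p y
  G.bilinearComp D D

theorem LorentzianMetric.inChart_apply (g : LorentzianMetric M) (p : M) (y v w : E3) :
    g.inChart p y v w =
      g.inner ((extChartAt (𝓡 3) p).symm y) (chartFrame p y v) (chartFrame p y w) := rfl

theorem contDiffAt_metric_inChart (g : LorentzianMetric M) {p : M} {y : E3}
    (hy : y ∈ (extChartAt (𝓡 3) p).target) : ContDiffAt ℝ ∞ (g.inChart p) y := by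
  refine ContDiffOn.contDiffAt ?_ (extChartAt_target_mem_nhds_of_mem hy)
  refine contDiffOn_clm_apply.2 fun v => contDiffOn_clm_apply.2 fun w z hz =>
    ContDiffAt.contDiffWithinAt ?_
  have h : ContMDiffAt 𝓘(ℝ, E3) ((𝓡 3).prod 𝓘(ℝ)) ∞
      (fun m ↦ TotalSpace.mk' ℝ (E := Bundle.Trivial M ℝ) ((extChartAt (𝓡 3) p).symm m)
        (g.inner ((extChartAt (𝓡 3) p).symm m) (chartFrame p m v) (chartFrame p m w))) z := by
    apply ContMDiffAt.clm_bundle_apply₂ (F₁ := E3) (F₂ := E3)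
    · exact g.contMDiff.contMDiffAt.comp z (contMDiffAt_extChartAt_symm hz)
    · exact contMDiffAt_chartFrame hz v
    · exact contMDiffAt_chartFrame hz w
  simp only [contMDiffAt_totalSpace] at h
  exact h.2.contDiffAt

/-- Components of a vector field in the chart at `p`. -/
noncomputable def chartField (p : M) (X : ∀ x : M, TangentSpace (𝓡 3) x) (y : E3) : E3 :=
  chartCoord p ((extChartAt (𝓡 3) p).symm y) (X ((extChartAt (𝓡 3) p).symm y))

theorem mpullback_extChartAt_symm_eventuallyEq {p : M} (X : ∀ x : M, TangentSpace (𝓡 3) x)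
    {y : E3} (hy : y ∈ (extChartAt (𝓡 3) p).target) :
    VectorField.mpullback 𝓘(ℝ, E3) (𝓡 3) (extChartAt (𝓡 3) p).symm X =ᶠ[𝓝 y]
      chartField p X := by
  filter_upwards [extChartAt_target_mem_nhds_of_mem hy] with z hz
  exact congrArg (fun T : E3 →L[ℝ] E3 => T (X ((extChartAt (𝓡 3) p).symm z)))
    (inverse_chartFrame hz)

/-- The Lie bracket is computed in components. -/
theorem chartField_mlieBracket {p : M} {X Y : ∀ x : M, TangentSpace (𝓡 3) x}
    {y : E3} (hy : y ∈ (extChartAt (𝓡 3) p).target)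
    (hX : ContMDiffAt (𝓡 3) (𝓡 3).tangent ∞ (fun x => (⟨x, X x⟩ : TangentBundle (𝓡 3) M))
      ((extChartAt (𝓡 3) p).symm y))
    (hY : ContMDiffAt (𝓡 3) (𝓡 3).tangent ∞ (fun x => (⟨x, Y x⟩ : TangentBundle (𝓡 3) M))
      ((extChartAt (𝓡 3) p).symm y)) :
    chartField p (VectorField.mlieBracket (𝓡 3) X Y) y =
      VectorField.lieBracket ℝ (chartField p X) (chartField p Y) y := by
  have h2 : minSmoothness ℝ 2 ≤ (∞ : ℕ∞ω) := by
    rw [minSmoothness_of_isRCLikeNormedField]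
    exact WithTop.coe_le_coe.2 (le_top : (2 : ℕ∞) ≤ ⊤)
  have : IsManifold (𝓡 3) (minSmoothness ℝ 2) M := IsManifold.of_le (n := ∞) h2
  have h := VectorField.mpullback_mlieBracket (n := ∞) (hX.mdifferentiableAt (by simp))
    (hY.mdifferentiableAt (by simp)) (contMDiffAt_extChartAt_symm hy) h2
  rw [(mpullback_extChartAt_symm_eventuallyEq _ hy).eq_of_nhds,
    (mpullback_extChartAt_symm_eventuallyEq X hy).mlieBracket_vectorField_eq
      (mpullback_extChartAt_symm_eventuallyEq Y hy)] at h
  refine h.trans ?_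
  have hb : ∀ V W : (x : E3) → TangentSpace 𝓘(ℝ, E3) x,
      VectorField.mlieBracket 𝓘(ℝ, E3) V W y = VectorField.lieBracket ℝ V W y := fun V W => by
    rw [← VectorField.mlieBracketWithin_univ,
      VectorField.mlieBracketWithin_eq_lieBracketWithin]
    exact congrFun (VectorField.lieBracketWithin_univ (V := V) (W := W)) y
  exact hb _ _

theorem contDiffAt_chartField {p : M} {X : ∀ x : M, TangentSpace (𝓡 3) x}
    {y : E3} (hy : y ∈ (extChartAt (𝓡 3) p).target)
    (hX : ContMDiffAt (𝓡 3) (𝓡 3).tangent ∞ (fun x => (⟨x, X x⟩ : TangentBundle (𝓡 3) M))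
      ((extChartAt (𝓡 3) p).symm y)) : ContDiffAt ℝ ∞ (chartField p X) y := by
  have : IsManifold (𝓡 3) 1 M := IsManifold.of_le (n := ∞) (by simp)
  have h := ContMDiffAt.mpullback_vectorField_preimage (n := ∞) (m := ∞) hX
    (contMDiffAt_extChartAt_symm hy)
    (by
      have := isInvertible_mfderivWithin_extChartAt_symm hy
      rwa [ModelWithCorners.range_eq_univ, mfderivWithin_univ] at this) (by simp)
  exact (contMDiffAt_vectorSpace_iff_contDiffAt.1 h).congr_of_eventuallyEq
    (mpullback_extChartAt_symm_eventuallyEq X hy).symm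

/-- A vector field is smooth where its components are. -/
theorem contMDiffAt_of_chartField {p : M} {X : ∀ x : M, TangentSpace (𝓡 3) x}
    {y : E3} (hy : y ∈ (extChartAt (𝓡 3) p).target) (hX : ContDiffAt ℝ ∞ (chartField p X) y) :
    ContMDiffAt (𝓡 3) (𝓡 3).tangent ∞ (fun x => (⟨x, X x⟩ : TangentBundle (𝓡 3) M))
      ((extChartAt (𝓡 3) p).symm y) := by
  refine (contMDiffAt_mpullback_extChartAt hy hX).congr_of_eventuallyEq ?_
  filter_upwards [(isOpen_extChartAt_source p).mem_nhds ((extChartAt (𝓡 3) p).map_target hy)]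
    with x hx
  obtain ⟨z, hz, rfl⟩ : ∃ z ∈ (extChartAt (𝓡 3) p).target, (extChartAt (𝓡 3) p).symm z = x :=
    ⟨_, (extChartAt (𝓡 3) p).map_source hx, (extChartAt (𝓡 3) p).left_inv hx⟩
  congr 1
  exact ((mpullback_extChartAt_apply hz (chartField p X)).trans (chartFrame_chartCoord hz _)).symm

/-! ### The exterior derivative in a chart -/

/-- The exterior derivative commutes with pullback because the second derivative of τ is symmetric
and drops out of the antisymmetrisation. -/
theorem fderiv_pullback_sub {a : E3 → E3 →L[ℝ] ℝ} {τ : E3 → E3} {z : E3}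
    (ha : DifferentiableAt ℝ a (τ z)) (hτ : ContDiffAt ℝ ∞ τ z) (v w : E3) :
    fderiv ℝ (fun x => (a (τ x)).comp (fderiv ℝ τ x)) z v w -
      fderiv ℝ (fun x => (a (τ x)).comp (fderiv ℝ τ x)) z w v =
    fderiv ℝ a (τ z) (fderiv ℝ τ z v) (fderiv ℝ τ z w) -
      fderiv ℝ a (τ z) (fderiv ℝ τ z w) (fderiv ℝ τ z v) := by
  have h2 : minSmoothness ℝ 2 ≤ (∞ : ℕ∞ω) := by
    rw [minSmoothness_of_isRCLikeNormedField]
    exact WithTop.coe_le_coe.2 (le_top : (2 : ℕ∞) ≤ ⊤)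
  have hs := (hτ.isSymmSndFDerivAt h2).eq v w
  have hτ' : DifferentiableAt ℝ (fderiv ℝ τ) z :=
    (hτ.fderiv_right (m := ∞) (by simp)).differentiableAt (by simp)
  have hd := ((ha.hasFDerivAt.comp z (hτ.differentiableAt (by simp)).hasFDerivAt).clm_comp
    hτ'.hasFDerivAt).fderiv
  simp only [Function.comp_def] at hd
  rw [hd]
  simp [hs]

/-- Near z the inverse chart at x factors through the transition map and the inverse chart at p.
`extDeriv` uses a different chart at each point, and this compares them with one fixed chart. -/
theorem OneForm.inChart_eq_pullback (α : OneForm M) {p x : M} {z : E3}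
    (hz : z ∈ (extChartAt (𝓡 3) x).target)
    (hz' : (extChartAt (𝓡 3) x).symm z ∈ (extChartAt (𝓡 3) p).source) :
    ContDiffAt ℝ ∞ (fun z => extChartAt (𝓡 3) p ((extChartAt (𝓡 3) x).symm z)) z ∧
    α.inChart x z = (α.inChart p (extChartAt (𝓡 3) p ((extChartAt (𝓡 3) x).symm z))).comp
      (fderiv ℝ (fun z => extChartAt (𝓡 3) p ((extChartAt (𝓡 3) x).symm z)) z) := by
  set τ : E3 → E3 := fun z => extChartAt (𝓡 3) p ((extChartAt (𝓡 3) x).symm z) with hτ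
  have hzp : τ z ∈ (extChartAt (𝓡 3) p).target := (extChartAt (𝓡 3) p).map_source hz'
  have hsrc : (extChartAt (𝓡 3) x).symm z ∈ (chartAt E3 p).source := by
    rwa [extChartAt_source] at hz'
  have hτs : ContMDiffAt 𝓘(ℝ, E3) 𝓘(ℝ, E3) ∞ τ z :=
    (contMDiffAt_extChartAt' (n := ∞) (I := 𝓡 3) hsrc).comp z (contMDiffAt_extChartAt_symm hz)
  refine ⟨hτs.contDiffAt, ?_⟩
  have hev : (extChartAt (𝓡 3) x).symm =ᶠ[𝓝 z] (extChartAt (𝓡 3) p).symm ∘ τ := by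
    have hc : ContinuousAt (extChartAt (𝓡 3) x).symm z :=
      (contMDiffAt_extChartAt_symm hz).continuousAt
    filter_upwards [hc.preimage_mem_nhds ((isOpen_extChartAt_source p).mem_nhds hz')] with t ht
    exact ((extChartAt (𝓡 3) p).left_inv ht).symm
  have hm : (chartFrame x z : E3 →L[ℝ] E3) =
      (chartFrame p (τ z) : E3 →L[ℝ] E3).comp (fderiv ℝ τ z) := by
    rw [← mfderiv_eq_fderiv]
    exact (hev.mfderiv_eq (I := 𝓘(ℝ, E3)) (I' := 𝓡 3)).trans
      (mfderiv_comp z ((contMDiffAt_extChartAt_symm hzp).mdifferentiableAt (by simp))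
        (hτs.mdifferentiableAt (by simp)))
  have hA : (α ((extChartAt (𝓡 3) x).symm z) : E3 →L[ℝ] ℝ) =
      α ((extChartAt (𝓡 3) p).symm (τ z)) :=
    congrArg (β := E3 →L[ℝ] ℝ) (fun m => α m) hev.eq_of_nhds
  have h := congrArg₂ (fun (A : E3 →L[ℝ] ℝ) (T : E3 →L[ℝ] E3) => A.comp T) hA hm
  exact h

/-- The exterior derivative may be computed in any chart. -/
theorem OneForm.extDeriv_chartFrame (α : OneForm M) {p : M} {y : E3}
    (hy : y ∈ (extChartAt (𝓡 3) p).target) (v w : E3) :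
    α.extDeriv ((extChartAt (𝓡 3) p).symm y) (chartFrame p y v) (chartFrame p y w) =
      fderiv ℝ (α.inChart p) y v w - fderiv ℝ (α.inChart p) y w v := by
  set x := (extChartAt (𝓡 3) p).symm y with hx
  have hxs : x ∈ (extChartAt (𝓡 3) p).source := (extChartAt (𝓡 3) p).map_target hy
  set τ : E3 → E3 := fun z => extChartAt (𝓡 3) p ((extChartAt (𝓡 3) x).symm z) with hτ
  set z := extChartAt (𝓡 3) x x with hz
  have hzt : z ∈ (extChartAt (𝓡 3) x).target := mem_extChartAt_target x
  have hzx : (extChartAt (𝓡 3) x).symm z = x := extChartAt_to_inv x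
  have hτz : τ z = y := by
    simp only [hτ, hzx]
    exact (extChartAt (𝓡 3) p).right_inv hy
  have hev : α.inChart x =ᶠ[𝓝 z] fun t => (α.inChart p (τ t)).comp (fderiv ℝ τ t) := by
    have hc : ContinuousAt (extChartAt (𝓡 3) x).symm z :=
      (contMDiffAt_extChartAt_symm hzt).continuousAt
    filter_upwards [extChartAt_target_mem_nhds_of_mem hzt, hc.preimage_mem_nhds
      ((isOpen_extChartAt_source p).mem_nhds (by rw [hzx]; exact hxs))] with t ht ht'
    exact (α.inChart_eq_pullback ht ht').2
  have hτs : ContDiffAt ℝ ∞ τ z :=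
    (α.inChart_eq_pullback (p := p) hzt (by rw [hzx]; exact hxs)).1
  -- By the chain rule the transition map turns components at x into components in the chart at p,
  -- where the frame vector has components u.
  have hc : ∀ u : E3, fderiv ℝ τ z (chartCoord x x (chartFrame p y u)) = u := fun u => by
    have h1 : (fun t => τ (extChartAt (𝓡 3) x t)) =ᶠ[𝓝 x] extChartAt (𝓡 3) p := by
      filter_upwards [extChartAt_source_mem_nhds (I := 𝓡 3) x] with t ht
      simp only [hτ, (extChartAt (𝓡 3) x).left_inv ht]
    have h2 : (chartCoord p x : E3 →L[ℝ] E3) = (fderiv ℝ τ z).comp (chartCoord x x) := by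
      rw [← mfderiv_eq_fderiv]
      exact (h1.symm.mfderiv_eq (I := 𝓡 3) (I' := 𝓘(ℝ, E3))).trans
        (mfderiv_comp x (hτs.differentiableAt (by simp)).mdifferentiableAt
          ((contMDiffAt_extChartAt (n := ∞)).mdifferentiableAt (by simp)))
    exact (congrArg (fun T : E3 →L[ℝ] E3 => T (chartFrame p y u)) h2).symm.trans
      (chartCoord_chartFrame hy u)
  have ha : DifferentiableAt ℝ (α.inChart p) (τ z) := by
    rw [hτz]
    exact (contDiffAt_inChart α hy).differentiableAt (by simp)
  have h := fderiv_pullback_sub ha hτs (chartCoord x x (chartFrame p y v))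
    (chartCoord x x (chartFrame p y w))
  rw [← hev.fderiv_eq, hc v, hc w, hτz] at h
  exact h

end Charts

/-! ### Null contact structures in a chart -/

section NullContact

variable {M : Type*} [TopologicalSpace M] [ChartedSpace E3 M] [IsManifold (𝓡 3) ∞ M]
  {o : ManifoldOrientation M} {g : LorentzianMetric M} {α : OneForm M}

theorem inner_reebField (g : LorentzianMetric M) (α : OneForm M) (p : M)
    (v : TangentSpace (𝓡 3) p) : g.inner p (reebField g α p) v = α p v :=
  apply_lorentzSharp (g.lorentzian p) (α p).toLinearMap v

theorem eq_zero_of_inner_eq_zero (g : LorentzianMetric M) {p : M} {v : TangentSpace (𝓡 3) p}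
    (h : ∀ w, g.inner p v w = 0) : v = 0 :=
  (g.lorentzian p).nondegenerate.1 v h

theorem IsNullContact.charEndo_charEndo (h : IsNullContact o g α) (p : M)
    (v : TangentSpace (𝓡 3) p) :
    charEndo o g α p (charEndo o g α p v) = -(α p v • reebField g α p) :=
  (charEndo_algebra (g.lorentzian p) (o.toFun p) (α := (α p).toLinearMap) (h.null p)).1 v

theorem IsNullContact.charEndo_reebField (h : IsNullContact o g α) (p : M) :
    charEndo o g α p (reebField g α p) = 0 :=
  (charEndo_algebra (g.lorentzian p) (o.toFun p) (α := (α p).toLinearMap) (h.null p)).2.1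

theorem IsNullContact.apply_charEndo (h : IsNullContact o g α) (p : M)
    (v : TangentSpace (𝓡 3) p) : α p (charEndo o g α p v) = 0 :=
  (charEndo_algebra (g.lorentzian p) (o.toFun p) (α := (α p).toLinearMap) (h.null p)).2.2.1 v

theorem IsNullContact.apply_reebField (h : IsNullContact o g α) (p : M) :
    α p (reebField g α p) = 0 :=
  (charEndo_algebra (g.lorentzian p) (o.toFun p) (α := (α p).toLinearMap) (h.null p)).2.2.2

theorem reebField_ne_zero {p : M} (h : α p ≠ 0) : reebField g α p ≠ 0 := fun h0 => h <| by
  ext v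
  rw [← inner_reebField g α, h0, map_zero]

/-- Inverting the Hodge star in α = ∗dα gives dα = -∗α, and φ is ι_v ∗α with its index raised. -/
theorem IsNullContact.extDeriv_eq (h : IsNullContact o g α) (p : M)
    (v w : TangentSpace (𝓡 3) p) :
    α.extDeriv p v w = -g.inner p (charEndo o g α p v) w := by
  let D : E3 →L[ℝ] E3 →L[ℝ] ℝ := fderiv ℝ (α.inChart p) (extChartAt (𝓡 3) p p)
  let β : TangentSpace (𝓡 3) p →ₗ[ℝ] TangentSpace (𝓡 3) p →ₗ[ℝ] ℝ :=
    (D.toLinearMap₁₂ - D.flip.toLinearMap₁₂).compl₁₂ (chartCoord p p).toLinearMap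
      (chartCoord p p).toLinearMap
  have hβ := eq_neg_hodgeStarOne_of_eq_hodgeStarTwo (g.lorentzian p) (o.toFun p) (β := β)
    (α := (α p).toLinearMap) (fun v w => (neg_sub _ _).symm) (h.eq_hodge p)
  have h1 : α.extDeriv p v w =
      -hodgeStarOne (g.lorentzian p) (o.toFun p) (α p).toLinearMap v w :=
    congrArg (fun b : TangentSpace (𝓡 3) p →ₗ[ℝ] TangentSpace (𝓡 3) p →ₗ[ℝ] ℝ => b v w) hβ
  rw [h1]
  exact congrArg Neg.neg (apply_lorentzSharp (g.lorentzian p) _ w).symm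

/-- The components of the characteristic endomorphism in the chart at `p`. -/
noncomputable def charEndoInChart (o : ManifoldOrientation M) (g : LorentzianMetric M)
    (α : OneForm M) (p : M) (y : E3) : E3 →L[ℝ] E3 :=
  LinearMap.toContinuousLinearMap
    ((chartCoord p ((extChartAt (𝓡 3) p).symm y)).toLinearMap ∘ₗ
      charEndo o g α ((extChartAt (𝓡 3) p).symm y) ∘ₗ (chartFrame p y).toLinearMap)

theorem charEndoInChart_apply (o : ManifoldOrientation M) (g : LorentzianMetric M)
    (α : OneForm M) (p : M) (y v : E3) :
    charEndoInChart o g α p y v = chartCoord p ((extChartAt (𝓡 3) p).symm y)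
      (charEndo o g α ((extChartAt (𝓡 3) p).symm y) (chartFrame p y v)) := rfl

variable {p : M} {y : E3}

theorem chartFrame_charEndoInChart (hy : y ∈ (extChartAt (𝓡 3) p).target) (v : E3) :
    chartFrame p y (charEndoInChart o g α p y v) =
      charEndo o g α ((extChartAt (𝓡 3) p).symm y) (chartFrame p y v) :=
  chartFrame_chartCoord hy _

theorem chartFrame_chartField (hy : y ∈ (extChartAt (𝓡 3) p).target)
    (X : ∀ x : M, TangentSpace (𝓡 3) x) :
    chartFrame p y (chartField p X y) = X ((extChartAt (𝓡 3) p).symm y) :=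
  chartFrame_chartCoord hy _

theorem chartField_charEndo (hy : y ∈ (extChartAt (𝓡 3) p).target)
    (X : ∀ x : M, TangentSpace (𝓡 3) x) :
    chartField p (fun x => charEndo o g α x (X x)) y =
      charEndoInChart o g α p y (chartField p X y) := by
  rw [charEndoInChart_apply, chartFrame_chartField hy]
  rfl

theorem OneForm.inChart_apply (α : OneForm M) (p : M) (y v : E3) :
    α.inChart p y v = α ((extChartAt (𝓡 3) p).symm y) (chartFrame p y v) := rfl

theorem eq_zero_of_metric_inChart_eq_zero (g : LorentzianMetric M)
    (hy : y ∈ (extChartAt (𝓡 3) p).target) {v : E3} (h : g.inChart p y v = 0) : v = 0 := by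
  have h0 : chartFrame p y v = 0 := eq_zero_of_inner_eq_zero g fun w => by
    rw [← chartFrame_chartCoord hy w, ← g.inChart_apply, h, _root_.zero_apply]
  rw [← chartCoord_chartFrame hy v, h0, map_zero]

theorem metric_inChart_reebField (hy : y ∈ (extChartAt (𝓡 3) p).target) :
    g.inChart p y (chartField p (reebField g α) y) = α.inChart p y := by
  ext v
  rw [g.inChart_apply, chartFrame_chartField hy, inner_reebField, α.inChart_apply]

theorem IsNullContact.fderiv_inChart_sub (h : IsNullContact o g α)
    (hy : y ∈ (extChartAt (𝓡 3) p).target) (v w : E3) :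
    fderiv ℝ (α.inChart p) y v w - fderiv ℝ (α.inChart p) y w v =
      -g.inChart p y (charEndoInChart o g α p y v) w := by
  rw [← α.extDeriv_chartFrame hy, h.extDeriv_eq, g.inChart_apply, chartFrame_charEndoInChart hy]

/-- Solutions of linear equations depend smoothly on the equation. -/
theorem contDiffAt_of_apply_eq {E : Type*} [NormedAddCommGroup E] [NormedSpace ℝ E]
    {G : E → E3 →L[ℝ] E3 →L[ℝ] ℝ} {u : E → E3} {b : E → E3 →L[ℝ] ℝ} {y : E}
    (hG : ContDiffAt ℝ ∞ G y) (hb : ContDiffAt ℝ ∞ b y)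
    (hinj : ∀ v, G y v = 0 → v = 0) (h : ∀ᶠ z in 𝓝 y, G z (u z) = b z) :
    ContDiffAt ℝ ∞ u y := by
  have hfr : finrank ℝ E3 = finrank ℝ (E3 →L[ℝ] ℝ) := by
    rw [← (LinearMap.toContinuousLinearMap (𝕜 := ℝ) (E := E3) (F' := ℝ)).finrank_eq]
    exact (Subspace.dual_finrank_eq).symm
  have hinj' : Function.Injective (G y).toLinearMap :=
    (injective_iff_map_eq_zero (G y).toLinearMap).2 hinj
  let e : E3 ≃L[ℝ] (E3 →L[ℝ] ℝ) :=
    (LinearEquiv.ofInjectiveOfFinrankEq (G y).toLinearMap hinj' hfr).toContinuousLinearEquiv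
  have he : (e : E3 →L[ℝ] E3 →L[ℝ] ℝ) = G y := by
    ext v w
    rfl
  have hinv : ContDiffAt ℝ ∞ (fun z => (G z).inverse (b z)) y := by
    have hi : ContDiffAt ℝ ∞ ContinuousLinearMap.inverse (G y) := he ▸ contDiffAt_map_inverse e
    exact (hi.comp y hG).clm_apply hb
  refine hinv.congr_of_eventuallyEq ?_
  have hrange : ∀ᶠ z in 𝓝 y, G z ∈ range ((↑) : (E3 ≃L[ℝ] (E3 →L[ℝ] ℝ)) → _) :=
    hG.continuousAt.eventually (ContinuousLinearEquiv.nhds e |> fun h => by rwa [he] at h)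
  filter_upwards [h, hrange] with z hz hz'
  obtain ⟨e', he'⟩ := hz'
  rw [← hz, ← he', ContinuousLinearMap.inverse_equiv]
  exact (e'.symm_apply_apply _).symm

theorem contDiffAt_chartField_reebField (g : LorentzianMetric M) (α : OneForm M)
    (hy : y ∈ (extChartAt (𝓡 3) p).target) :
    ContDiffAt ℝ ∞ (chartField p (reebField g α)) y :=
  contDiffAt_of_apply_eq (contDiffAt_metric_inChart g hy) (contDiffAt_inChart α hy)
    (fun _ => eq_zero_of_metric_inChart_eq_zero g hy)
    (Filter.Eventually.mono (extChartAt_target_mem_nhds_of_mem hy)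
      fun _ => metric_inChart_reebField)

/-- The vector φv is the solution of g(φv, ·) = -dα(v, ·), a linear equation with smooth
coefficients. The volume form therefore never has to be differentiated. -/
theorem IsNullContact.contDiffAt_charEndoInChart (h : IsNullContact o g α)
    (hy : y ∈ (extChartAt (𝓡 3) p).target) :
    ContDiffAt ℝ ∞ (charEndoInChart o g α p) y := by
  refine ContDiffOn.contDiffAt ?_ (extChartAt_target_mem_nhds_of_mem hy)
  refine contDiffOn_clm_apply.2 fun v z hz => ContDiffAt.contDiffWithinAt ?_
  have hd : ContDiffAt ℝ ∞ (fderiv ℝ (α.inChart p)) z :=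
    (contDiffAt_inChart α hz).fderiv_right (m := ∞) (by simp)
  refine contDiffAt_of_apply_eq (b := fun t => -(fderiv ℝ (α.inChart p) t v -
    (fderiv ℝ (α.inChart p) t).flip v)) (contDiffAt_metric_inChart g hz) ?_
    (fun _ => eq_zero_of_metric_inChart_eq_zero g hz)
    (Filter.Eventually.mono (extChartAt_target_mem_nhds_of_mem hz) fun t ht => ?_)
  · have hf : ContDiffAt ℝ ∞ (fun t => (fderiv ℝ (α.inChart p) t).flip v) z := by
      refine ContDiffOn.contDiffAt ?_ (extChartAt_target_mem_nhds_of_mem hz)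
      refine contDiffOn_clm_apply.2 fun w t ht => ContDiffAt.contDiffWithinAt ?_
      exact (((contDiffAt_inChart α ht).fderiv_right (m := ∞) (by simp)).clm_apply
        contDiffAt_const).clm_apply contDiffAt_const
    exact ((hd.clm_apply contDiffAt_const).sub hf).neg
  · ext w
    change _ = -(fderiv ℝ (α.inChart p) t v w - fderiv ℝ (α.inChart p) t w v)
    rw [h.fderiv_inChart_sub ht, neg_neg]

end NullContact

/-! ### The Sasakian condition and integrability -/

section Integrability

variable {M : Type*} [TopologicalSpace M] [ChartedSpace E3 M] [IsManifold (𝓡 3) ∞ M]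
  {o : ManifoldOrientation M} {g : LorentzianMetric M} {α : OneForm M}

theorem IsNullContact.contactJ_comp_self (h : IsNullContact o g α) (x : M × ℝ) :
    contactJ o g α x ∘ₗ contactJ o g α x = 0 := by
  refine LinearMap.ext fun u => ?_
  obtain ⟨v, c⟩ : TangentSpace (𝓡 3) x.1 × ℝ := u
  have h1 : charEndo o g α x.1 (charEndo o g α x.1 v + c • reebField g α x.1) +
      α x.1 v • reebField g α x.1 = 0 := by
    rw [map_add, map_smul, h.charEndo_charEndo, h.charEndo_reebField, smul_zero, add_zero,
      neg_add_cancel]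
  have h2 : α x.1 (charEndo o g α x.1 v + c • reebField g α x.1) = 0 := by
    rw [map_add, map_smul, h.apply_charEndo, h.apply_reebField, smul_zero, add_zero]
  exact Prod.ext h1 h2

variable {p : M} {y : E3}

/-- The tensor `L_ξ φ` in components. -/
theorem IsNullContact.chartField_lieDerivEndo (h : IsNullContact o g α)
    (hy : y ∈ (extChartAt (𝓡 3) p).target) {X : ∀ x : M, TangentSpace (𝓡 3) x}
    (hX : ContMDiffAt (𝓡 3) (𝓡 3).tangent ∞ (fun x => (⟨x, X x⟩ : TangentBundle (𝓡 3) M))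
      ((extChartAt (𝓡 3) p).symm y)) :
    chartField p (lieDerivEndo (reebField g α) (charEndo o g α) X) y =
      VectorField.lieBracket ℝ (chartField p (reebField g α))
          (fun z => charEndoInChart o g α p z (chartField p X z)) y -
        charEndoInChart o g α p y
          (VectorField.lieBracket ℝ (chartField p (reebField g α)) (chartField p X) y) := by
  have hev : chartField p (fun x => charEndo o g α x (X x)) =ᶠ[𝓝 y]
      fun z => charEndoInChart o g α p z (chartField p X z) :=
    Filter.Eventually.mono (extChartAt_target_mem_nhds_of_mem hy)
      fun z hz => chartField_charEndo hz X
  have hξ := contMDiffAt_of_chartField hy (contDiffAt_chartField_reebField g α hy)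
  have hφX := contMDiffAt_of_chartField (X := fun x => charEndo o g α x (X x)) hy
    (((h.contDiffAt_charEndoInChart hy).clm_apply
      (contDiffAt_chartField hy hX)).congr_of_eventuallyEq hev)
  have h1 := chartField_mlieBracket hy hξ hφX
  have h2 := chartField_mlieBracket hy hξ hX
  have h3 := chartField_charEndo (o := o) (g := g) (α := α) hy
    (VectorField.mlieBracket (𝓡 3) (reebField g α) X)
  rw [EventuallyEq.rfl.lieBracket_vectorField_eq hev] at h1
  rw [h2] at h3
  rw [← h1, ← h3]
  exact map_sub (chartCoord p ((extChartAt (𝓡 3) p).symm y)) _ _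

/-- Every constant vector field in a chart agrees near the center with a global smooth one. -/
theorem exists_isSmoothVectorField_chartField_eventuallyEq [T2Space M] (p : M) (n : E3) :
    ∃ X : ∀ x : M, TangentSpace (𝓡 3) x, IsSmoothVectorField X ∧
      chartField p X =ᶠ[𝓝 (extChartAt (𝓡 3) p p)] fun _ => n := by
  obtain ⟨f⟩ : Nonempty (SmoothBumpFunction (𝓡 3) p) := inferInstance
  let Y : ∀ x : M, TangentSpace (𝓡 3) x :=
    VectorField.mpullback (𝓡 3) 𝓘(ℝ, E3) (extChartAt (𝓡 3) p) fun _ => n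
  refine ⟨fun x => f x • Y x, ?_, ?_⟩
  · refine ContMDiffOn.smul_section_of_tsupport (V := fun x : M => TangentSpace (𝓡 3) x)
      f.contMDiff.contMDiffOn (chartAt E3 p).open_source f.tsupport_subset_chartAt_source ?_
    intro x hx
    rw [← extChartAt_source (𝓡 3)] at hx
    have := contMDiffAt_mpullback_extChartAt ((extChartAt (𝓡 3) p).map_source hx)
      (contDiffAt_const (c := n))
    rw [(extChartAt (𝓡 3) p).left_inv hx] at this
    exact this.contMDiffWithinAt
  · have hc : Tendsto (extChartAt (𝓡 3) p).symm (𝓝 (extChartAt (𝓡 3) p p)) (𝓝 p) := by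
      have h := continuousAt_extChartAt_symm (I := 𝓡 3) p
      rwa [ContinuousAt, extChartAt_to_inv] at h
    filter_upwards [hc.eventually f.eventuallyEq_one,
      extChartAt_target_mem_nhds_of_mem (mem_extChartAt_target (I := 𝓡 3) p)] with z hz hz'
    have h1 : chartField p (fun x => f x • Y x) z =
        f ((extChartAt (𝓡 3) p).symm z) • chartField p Y z :=
      map_smul (chartCoord p ((extChartAt (𝓡 3) p).symm z)) _ _
    rw [h1, hz, Pi.one_apply, one_smul]
    exact (congrArg (chartCoord p ((extChartAt (𝓡 3) p).symm z))
      (mpullback_extChartAt_apply hz' fun _ => n)).trans (chartCoord_chartFrame hz' n)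

/-- The Sasakian condition tests global vector fields, whereas the local construction needs
coordinate fields. A bump function extends a coordinate field without changing it near the centre,
and brackets depend only on germs. -/
theorem IsSasakian.eventually_lieBracket_eq [T2Space M] (h : IsNullContact o g α)
    (hs : IsSasakian o g α) (p : M) (n : E3) :
    ∀ᶠ y in 𝓝 (extChartAt (𝓡 3) p p),
      VectorField.lieBracket ℝ (chartField p (reebField g α))
          (fun z => charEndoInChart o g α p z n) y =
        charEndoInChart o g α p y
          (VectorField.lieBracket ℝ (chartField p (reebField g α)) (fun _ => n) y) := by
  obtain ⟨X, hX, hXn⟩ := exists_isSmoothVectorField_chartField_eventuallyEq p n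
  filter_upwards [hXn.eventuallyEq_nhds,
    extChartAt_target_mem_nhds_of_mem (mem_extChartAt_target (I := 𝓡 3) p)] with y hy hyt
  have h1 := h.chartField_lieDerivEndo hyt (hX _)
  have h0 : chartField p (lieDerivEndo (reebField g α) (charEndo o g α) X) y = 0 := by
    rw [chartField, hs X hX, map_zero]
  have h2 : (fun z => charEndoInChart o g α p z (chartField p X z)) =ᶠ[𝓝 y]
      fun z => charEndoInChart o g α p z n := hy.mono fun z hz => by
    simp only [hz]
  rw [h0, EventuallyEq.rfl.lieBracket_vectorField_eq h2,
    EventuallyEq.rfl.lieBracket_vectorField_eq hy] at h1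
  exact sub_eq_zero.1 h1.symm

/-! ### Charts of M × ℝ that are the identity on ℝ. -/

theorem hasMFDerivAt_extChartAt_prod {x : M × ℝ} (hx : x.1 ∈ (extChartAt (𝓡 3) p).source) :
    HasMFDerivAt ((𝓡 3).prod 𝓘(ℝ, ℝ)) 𝓘(ℝ, E3 × ℝ)
      (fun x : M × ℝ => (extChartAt (𝓡 3) p x.1, x.2)) x
      (((chartCoord p x.1).comp (ContinuousLinearMap.fst ℝ (TangentSpace (𝓡 3) x.1) ℝ)).prod
        (ContinuousLinearMap.snd ℝ (TangentSpace (𝓡 3) x.1) ℝ)) := by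
  rw [extChartAt_source] at hx
  have h1 := (mdifferentiableAt_extChartAt (I := 𝓡 3) hx).hasMFDerivAt.comp x
    (hasMFDerivAt_fst (I := 𝓡 3) (I' := 𝓘(ℝ, ℝ)) x)
  have h2 := hasMFDerivAt_snd (I := 𝓡 3) (I' := 𝓘(ℝ, ℝ)) x
  exact ⟨h1.1.prodMk h2.1, h1.2.prodMk h2.2⟩

theorem contMDiffAt_extChartAt_prod {x : M × ℝ} (hx : x.1 ∈ (extChartAt (𝓡 3) p).source) :
    ContMDiffAt ((𝓡 3).prod 𝓘(ℝ, ℝ)) 𝓘(ℝ, E3 × ℝ) ∞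
      (fun x : M × ℝ => (extChartAt (𝓡 3) p x.1, x.2)) x := by
  rw [extChartAt_source] at hx
  exact ((contMDiffAt_extChartAt' hx).comp x contMDiffAt_fst).prodMk_space contMDiffAt_snd

theorem contMDiffAt_extChartAt_symm_prod {z : E3 × ℝ}
    (hz : z.1 ∈ (extChartAt (𝓡 3) p).target) :
    ContMDiffAt 𝓘(ℝ, E3 × ℝ) ((𝓡 3).prod 𝓘(ℝ, ℝ)) ∞
      (fun z : E3 × ℝ => ((extChartAt (𝓡 3) p).symm z.1, z.2)) z :=
  ((contMDiffAt_extChartAt_symm hz).comp z contDiff_fst.contMDiff.contMDiffAt).prodMk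
    contDiff_snd.contMDiff.contMDiffAt

theorem hasMFDerivAt_extChartAt_symm_prod {z : E3 × ℝ}
    (hz : z.1 ∈ (extChartAt (𝓡 3) p).target) :
    HasMFDerivAt 𝓘(ℝ, E3 × ℝ) ((𝓡 3).prod 𝓘(ℝ, ℝ))
      (fun z : E3 × ℝ => ((extChartAt (𝓡 3) p).symm z.1, z.2)) z
      (((chartFrame p z.1).comp (ContinuousLinearMap.fst ℝ E3 ℝ)).prod
        (ContinuousLinearMap.snd ℝ E3 ℝ)) :=
  (((contMDiffAt_extChartAt_symm hz).mdifferentiableAt (by simp)).hasMFDerivAt.comp z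
    (ContinuousLinearMap.fst ℝ E3 ℝ).hasMFDerivAt).prodMk
    (ContinuousLinearMap.snd ℝ E3 ℝ).hasMFDerivAt

theorem contMDiffAt_extend_symm {E H N : Type*} [NormedAddCommGroup E] [NormedSpace ℝ E]
    [TopologicalSpace H] {I : ModelWithCorners ℝ E H} [I.Boundaryless] [TopologicalSpace N]
    [ChartedSpace H N] {n : ℕ∞ω} {e : OpenPartialHomeomorph N H}
    (he : e ∈ IsManifold.maximalAtlas I n N) {x : N} (hx : x ∈ e.source) :
    ContMDiffAt 𝓘(ℝ, E) I n (e.extend I).symm (e.extend I x) := by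
  have h : I.symm (e.extend I x) = e x := I.left_inv (e x)
  have h1 := contMDiffAt_symm_of_mem_maximalAtlas he (e.map_source hx)
  rw [← h] at h1
  exact h1.comp (e.extend I x) (I.contMDiffOn_symm.contMDiffAt (by simp [I.range_eq_univ]))

omit [IsManifold (𝓡 3) ∞ M] in
theorem exists_mem_target_of_mem_source {x : M} (hx : x ∈ (extChartAt (𝓡 3) p).source) :
    ∃ y ∈ (extChartAt (𝓡 3) p).target, (extChartAt (𝓡 3) p).symm y = x :=
  ⟨_, (extChartAt (𝓡 3) p).map_source hx, (extChartAt (𝓡 3) p).left_inv hx⟩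

theorem charEndoInChart_chartCoord {x : M} (hx : x ∈ (extChartAt (𝓡 3) p).source)
    (v : TangentSpace (𝓡 3) x) :
    charEndoInChart o g α p (extChartAt (𝓡 3) p x) (chartCoord p x v) =
      chartCoord p x (charEndo o g α x v) := by
  obtain ⟨y, hy, rfl⟩ := exists_mem_target_of_mem_source hx
  rw [(extChartAt (𝓡 3) p).right_inv hy, charEndoInChart_apply, chartFrame_chartCoord hy]

omit [IsManifold (𝓡 3) ∞ M] in
theorem chartField_extChartAt {x : M} (hx : x ∈ (extChartAt (𝓡 3) p).source)
    (X : ∀ x : M, TangentSpace (𝓡 3) x) :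
    chartField p X (extChartAt (𝓡 3) p x) = chartCoord p x (X x) := by
  obtain ⟨y, hy, rfl⟩ := exists_mem_target_of_mem_source hx
  rw [(extChartAt (𝓡 3) p).right_inv hy]
  rfl

theorem inChart_chartCoord {x : M} (hx : x ∈ (extChartAt (𝓡 3) p).source)
    (v : TangentSpace (𝓡 3) x) :
    α.inChart p (extChartAt (𝓡 3) p x) (chartCoord p x v) = α x v := by
  obtain ⟨y, hy, rfl⟩ := exists_mem_target_of_mem_source hx
  rw [(extChartAt (𝓡 3) p).right_inv hy, α.inChart_apply, chartFrame_chartCoord hy]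

/-- The flattening coordinates are composed with the inverse chart of M times the identity, which
reduces the claim to model space. Since J does not depend on q, the slice q = 0 suffices. -/
theorem IsNullContact.isSasakian_of_isIntegrableEndo (h : IsNullContact o g α)
    (hJ : IsIntegrableEndo ((𝓡 3).prod 𝓘(ℝ, ℝ)) (contactJ o g α)) : IsSasakian o g α := by
  intro X hX p
  obtain ⟨e, he, hpe, A, hA⟩ := hJ (p, 0)
  set z₀ : E3 × ℝ := (extChartAt (𝓡 3) p p, 0)
  let Φ : E3 × ℝ → M × ℝ := fun z => ((extChartAt (𝓡 3) p).symm z.1, z.2)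
  let Ψ : M × ℝ → E3 × ℝ := fun x => (extChartAt (𝓡 3) p x.1, x.2)
  let I := (𝓡 3).prod 𝓘(ℝ, ℝ)
  have hyt : extChartAt (𝓡 3) p p ∈ (extChartAt (𝓡 3) p).target := mem_extChartAt_target p
  have hΦ₀ : Φ z₀ = (p, 0) := Prod.ext (extChartAt_to_inv p) rfl
  have hΦ : ∀ z : E3 × ℝ, z.1 ∈ (extChartAt (𝓡 3) p).target →
      ContMDiffAt 𝓘(ℝ, E3 × ℝ) I ∞ Φ z := fun z hz => contMDiffAt_extChartAt_symm_prod hz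
  have hev : ∀ᶠ z in 𝓝 z₀, z.1 ∈ (extChartAt (𝓡 3) p).target ∧ Φ z ∈ e.source := by
    refine (continuousAt_fst.eventually (extChartAt_target_mem_nhds_of_mem hyt)).and ?_
    exact (hΦ z₀ hyt).continuousAt.eventually
      (e.open_source.mem_nhds (by rw [hΦ₀]; exact hpe))
  have hes : ∀ x ∈ e.source, ContMDiffAt I 𝓘(ℝ, E3 × ℝ) ∞ (e.extend I) x := fun x hx =>
    e.contMDiffAt_extend he hx
  let F : E3 × ℝ → E3 × ℝ := fun z => e.extend I (Φ z)
  have hF : ContDiffAt ℝ ∞ F z₀ :=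
    ((hes (Φ z₀) (by rw [hΦ₀]; exact hpe)).comp z₀ (hΦ z₀ hyt)).contDiffAt
  have hdF : ∀ z : E3 × ℝ, z.1 ∈ (extChartAt (𝓡 3) p).target → Φ z ∈ e.source → ∀ (v : E3)
      (c : ℝ), fderiv ℝ F z (v, c) = mfderiv I 𝓘(ℝ, E3 × ℝ) (e.extend I) (Φ z)
        ((chartFrame p z.1 v, c) : TangentSpace (𝓡 3) (Φ z).1 × ℝ) := fun z hz hz' v c => by
    have h1 := (((hes _ hz').mdifferentiableAt (by simp)).hasMFDerivAt.comp z
      (hasMFDerivAt_extChartAt_symm_prod hz)).mfderiv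
    rw [← mfderiv_eq_fderiv]
    exact congrArg (fun T : E3 × ℝ →L[ℝ] E3 × ℝ => T (v, c)) h1
  have hinj : Function.Injective (fderiv ℝ F z₀) := by
    -- A smooth local left inverse of F makes its derivative injective.
    let G : E3 × ℝ → E3 × ℝ := fun w => Ψ ((e.extend I).symm w)
    have hG : ContDiffAt ℝ ∞ G (F z₀) := by
      have h1 : ContMDiffAt 𝓘(ℝ, E3 × ℝ) I ∞ (e.extend I).symm (F z₀) :=
        contMDiffAt_extend_symm he hev.self_of_nhds.2
      have h2 : (e.extend I).symm (F z₀) = Φ z₀ := e.extend_left_inv hev.self_of_nhds.2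
      have h3 : ContMDiffAt I 𝓘(ℝ, E3 × ℝ) ∞ Ψ ((e.extend I).symm (F z₀)) := by
        rw [h2]
        exact contMDiffAt_extChartAt_prod ((extChartAt (𝓡 3) p).map_target hyt)
      exact (h3.comp _ h1).contDiffAt
    have hGF : (fun z => G (F z)) =ᶠ[𝓝 z₀] id := by
      filter_upwards [hev] with z hz
      change Ψ ((e.extend I).symm (e.extend I (Φ z))) = z
      rw [e.extend_left_inv hz.2]
      exact Prod.ext ((extChartAt (𝓡 3) p).right_inv hz.1) rfl
    have h1 := hGF.fderiv_eq (𝕜 := ℝ)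
    have h2 : fderiv ℝ (fun z => G (F z)) z₀ = (fderiv ℝ G (F z₀)).comp (fderiv ℝ F z₀) :=
      fderiv_comp z₀ (hG.differentiableAt (by simp)) (hF.differentiableAt (by simp))
    rw [h2, fderiv_id] at h1
    exact Function.LeftInverse.injective (g := fderiv ℝ G (F z₀)) fun v =>
      congrArg (fun T : E3 × ℝ →L[ℝ] E3 × ℝ => T v) h1
  have key := lieBracket_eq_of_constant_coefficients (ξ := chartField p (reebField g α))
    (φ := charEndoInChart o g α p) (α := α.inChart p) (X := chartField p X) hF hinj
    (LinearMap.toContinuousLinearMap (E := E3 × ℝ) (F' := E3 × ℝ) A)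
    (hev.mono fun z hz v c => by
      rw [hdF z hz.1 hz.2, hdF z hz.1 hz.2]
      have := hA (Φ z) hz.2 ((chartFrame p z.1 v, c) : TangentSpace (𝓡 3) (Φ z).1 × ℝ)
      rw [contactJ_apply] at this
      rw [map_add, map_smul, chartFrame_charEndoInChart hz.1, chartFrame_chartField hz.1]
      exact this)
    ((contDiffAt_chartField_reebField g α hyt).differentiableAt (by simp))
    ((h.contDiffAt_charEndoInChart hyt).differentiableAt (by simp))
    ((contDiffAt_inChart α hyt).differentiableAt (by simp))
    ((contDiffAt_chartField hyt (hX _)).differentiableAt (by simp))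
  have h0 := h.chartField_lieDerivEndo hyt (hX _)
  rw [sub_eq_zero.2 key] at h0
  have h1 := chartFrame_chartField hyt (lieDerivEndo (reebField g α) (charEndo o g α) X)
  rw [h0, map_zero, extChartAt_to_inv] at h1
  exact h1.symm

/-- In a chart, the algebra of φ, the formula dα(φv, w) = α(v) α(w) and the invariance on coordinate
fields are the hypotheses of `exists_constant_coefficients`. The coordinates it yields are
precomposed with the chart of M times the identity of ℝ. -/
theorem IsSasakian.isIntegrableEndo [T2Space M] (hs : IsSasakian o g α)
    (h : IsNullContact o g α) (hne : ∀ p : M, α p ≠ 0) :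
    IsIntegrableEndo ((𝓡 3).prod 𝓘(ℝ, ℝ)) (contactJ o g α) := by
  rintro ⟨p, q⟩
  have hyt : extChartAt (𝓡 3) p p ∈ (extChartAt (𝓡 3) p).target := mem_extChartAt_target p
  have hev : ∀ᶠ y in 𝓝 (extChartAt (𝓡 3) p p), y ∈ (extChartAt (𝓡 3) p).target :=
    extChartAt_target_mem_nhds_of_mem hyt
  have hinj : ∀ y ∈ (extChartAt (𝓡 3) p).target, ∀ v w, chartFrame p y v = chartFrame p y w →
      v = w := fun y hy v w hvw => by
    rw [← chartCoord_chartFrame hy v, hvw, chartCoord_chartFrame hy]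
  obtain ⟨e, hpe, he⟩ := exists_constant_coefficients (y₀ := extChartAt (𝓡 3) p p)
    (ξ := chartField p (reebField g α)) (φ := charEndoInChart o g α p) (α := α.inChart p)
    (hev.mono fun y hy => contDiffAt_chartField_reebField g α hy)
    (hev.mono fun y hy => h.contDiffAt_charEndoInChart hy)
    (hev.mono fun y hy => contDiffAt_inChart α hy)
    (hev.mono fun y hy h0 => reebField_ne_zero (g := g) (hne _) (by
      rw [← chartFrame_chartField hy (reebField g α), h0, map_zero]))
    (fun h0 => hne ((extChartAt (𝓡 3) p).symm (extChartAt (𝓡 3) p p)) (by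
      ext v
      rw [← chartFrame_chartCoord hyt v, ← α.inChart_apply, h0]
      rfl))
    (hev.mono fun y hy v => hinj y hy _ _ (by
      rw [chartFrame_charEndoInChart hy, chartFrame_charEndoInChart hy, h.charEndo_charEndo,
        map_neg, map_smul, chartFrame_chartField hy, α.inChart_apply]))
    (hev.mono fun y hy => hinj y hy _ _ (by
      rw [chartFrame_charEndoInChart hy, chartFrame_chartField hy, h.charEndo_reebField,
        map_zero]))
    (hev.mono fun y hy v => by
      rw [α.inChart_apply, chartFrame_charEndoInChart hy, h.apply_charEndo])
    (hev.mono fun y hy => by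
      rw [α.inChart_apply, chartFrame_chartField hy, h.apply_reebField])
    (hev.mono fun y hy v w => by
      rw [h.fderiv_inChart_sub hy, g.inChart_apply, chartFrame_charEndoInChart hy,
        chartFrame_charEndoInChart hy, h.charEndo_charEndo, map_neg, map_smul,
        _root_.neg_apply, _root_.smul_apply, inner_reebField, neg_neg]
      rfl)
    (hs.eventually_lieBracket_eq h p) q
  let I := (𝓡 3).prod 𝓘(ℝ, ℝ)
  -- Membership in the maximal atlas amounts to smoothness of this composite and of its inverse.
  let e' : OpenPartialHomeomorph (M × ℝ) (ModelProd E3 ℝ) :=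
    ((chartAt E3 p).prod (OpenPartialHomeomorph.refl ℝ)).trans e
  have hsource : ∀ x ∈ e'.source, x.1 ∈ (extChartAt (𝓡 3) p).source ∧
      (extChartAt (𝓡 3) p x.1, x.2) ∈ e.source := fun x hx => by
    rw [extChartAt_source]
    exact ⟨hx.1.1, hx.2⟩
  have hψ : ∀ x ∈ e'.source, ContMDiffAt I 𝓘(ℝ, E3 × ℝ) ∞
      (fun x : M × ℝ => e (extChartAt (𝓡 3) p x.1, x.2)) x := fun x hx =>
    (he _ (hsource x hx).2).1.contMDiffAt.comp x (contMDiffAt_extChartAt_prod (hsource x hx).1)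
  refine ⟨e', ?_, ⟨⟨mem_chart_source E3 p, mem_univ _⟩, hpe⟩, nilpotentModel.toLinearMap,
    fun x hx u => ?_⟩
  · refine OpenPartialHomeomorph.mem_maximalAtlas_of_contMDiffOn e' (fun x hx => ?_)
      (fun w hw => ?_)
    · exact ((I.contMDiffOn_symm.contMDiffAt (by simp [I.range_eq_univ])).comp x
        (hψ x hx)).contMDiffWithinAt
    · have hz := (he _ (e.map_target hw.1)).2.1
      rw [e.right_inv hw.1] at hz
      have ht : (e.symm w).1 ∈ (extChartAt (𝓡 3) p).target := by
        rw [extChartAt_target]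
        exact ⟨hw.2.1, mem_range_self _⟩
      have h1 : ContMDiffAt 𝓘(ℝ, E3 × ℝ) I ∞ (fun w : E3 × ℝ =>
          ((extChartAt (𝓡 3) p).symm (e.symm w).1, (e.symm w).2)) (I w) :=
        ContMDiffAt.comp (M := E3 × ℝ) w (contMDiffAt_extChartAt_symm_prod ht) hz.contMDiffAt
      exact (ContMDiffAt.comp (M := ModelProd E3 ℝ) (M' := E3 × ℝ) (I := I) w h1
        (I.contMDiff w)).contMDiffWithinAt
  · obtain ⟨v, c⟩ : TangentSpace (𝓡 3) x.1 × ℝ := u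
    obtain ⟨hx1, hx2⟩ := hsource x hx
    have hd := (HasMFDerivAt.comp x
      ((he _ hx2).1.differentiableAt (by simp)).hasFDerivAt.hasMFDerivAt
      (hasMFDerivAt_extChartAt_prod hx1)).mfderiv
    have hT : ∀ (v : TangentSpace (𝓡 3) x.1) (c : ℝ),
        mfderiv I 𝓘(ℝ, E3 × ℝ) (e'.extend I) x ((v, c) : TangentSpace (𝓡 3) x.1 × ℝ) =
          fderiv ℝ e (extChartAt (𝓡 3) p x.1, x.2) (chartCoord p x.1 v, c) := fun v c =>
      congrArg (fun T : E3 × ℝ →L[ℝ] E3 × ℝ => T (v, c)) hd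
    have hm := (he _ hx2).2.2 (chartCoord p x.1 v) c
    rw [← hT v c] at hm
    refine Eq.trans ?_ hm
    rw [contactJ_apply, hT, charEndoInChart_chartCoord hx1, chartField_extChartAt hx1,
      inChart_chartCoord hx1, map_add, map_smul]

end Integrability

theorem mainTheorem9 {M : Type*} [TopologicalSpace M] [T2Space M] [SecondCountableTopology M]
    [ChartedSpace E3 M] [IsManifold (𝓡 3) ∞ M]
    (o : ManifoldOrientation M) (g : LorentzianMetric M) (α : OneForm M)
    (hα : IsNullContact o g α) (hne : ∀ p : M, α p ≠ 0) :
    (∀ x : M × ℝ, contactJ o g α x ∘ₗ contactJ o g α x = 0) ∧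
      (IsSasakian o g α ↔ IsIntegrableEndo ((𝓡 3).prod 𝓘(ℝ, ℝ)) (contactJ o g α)) := by
  exact ⟨hα.contactJ_comp_self, fun hs => hs.isIntegrableEndo hα hne,
    hα.isSasakian_of_isIntegrableEndo⟩
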